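/- Let $Q=\{(x,t)\in\mathbb{R}^2: x>0,\ t>0\}$ and $\bar Q=\{(x,t)\in\mathbb{R}^2: x\ge 0,\ t\ge 0\}$. A $C^\infty$ function $f:(0,\infty)\to\mathbb{C}$ belongs to $C^\infty([0,\infty))$ if $\lim_{x\to0^+}f^{(N)}(x)$ exists in $\mathbb{C}$ for every integer $N\ge0$; it belongs to $\mathcal{S}([0,\infty))$ if, in addition, $\sup_{x>0}|x^M f^{(N)}(x)|<\infty$ for all integers $M,N\ge 0$. Let $u_0\in\mathcal{S}([0,\infty))$ and $g_0\in C^\infty([0,\infty))$, and put $$\hat u_0(\lambda)=\int_0^\infty u_0(x)e^{-i\lambda x}\,dx\quad(\lambda\in\mathbb{C},\ \operatorname{Im}\lambda\le0),\qquad \tilde g_0(\lambda,t)=\int_0^t e^{\lambda^2\tau}g_0(\tau)\,d\tau\quad(\lambda\in\mathbb{C},\ t>0).$$ Let $\Gamma=\{\lambda\in\mathbb{C}:\operatorname{Im}\lambda\ge0,\ \operatorname{Re}(\lambda^2)=0\}$ be the positively oriented boundary of $\{\lambda\in\mathbb{C}:\operatorname{Im}\lambda\ge0,\ \operatorname{Re}(\lambda^2)\le0\}$,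 i.e. $\Gamma$ runs from infinity along the ray $\arg\lambda=3\pi/4$ to $0$ and then along the ray $\arg\lambda=\pi/4$ to infinity. For $(x,t)\in Q$ define the Fokas solution of the heat equation $u_t=u_{xx}$ on the half line with initial datum $u_0$ and Dirichlet boundary datum $g_0$ by $$u(x,t)=\frac1{2\pi}\int_{-\infty}^{\infty}e^{i\lambda x-\lambda^2t}\,\hat u_0(\lambda)\,d\lambda-\frac1{2\pi}\int_{\Gamma}e^{i\lambda x-\lambda^2t}\,\hat u_0(-\lambda)\,d\lambda-\frac{i}{\pi}\int_{\Gamma}e^{i\lambda x-\lambda^2t}\,\lambda\,\tilde g_0(\lambda,t)\,d\lambda .$$ Theorem 1.2. The function $u$ extends to a $C^\infty$ function on $\bar Q\setminus\{(0,0)\}$; in particular $u$ is $C^\infty$ on $Q$, and for all integers $k,\ell\ge0$ the derivative $\dfrac{\partial^{k+\ell}u}{\partial x^k\partial t^\ell}$, defined on $Q$, extends to a continuous function on $\bar Q\setminus\{(0,0)\}$. -/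

import Mathlib

open Set Filter Topology MeasureTheory
open scoped ContDiff

noncomputable section

/-- The space `C^∞([0,∞))`: `f` is `C^∞` on the open half line `(0,∞)` and the limit of every
derivative `f^(N)(x)`, as `x → 0⁺`, exists. Only the values of `f` on `(0,∞)` matter. -/
def IsSmoothHalfLine (f : ℝ → ℂ) : Prop :=
  ContDiffOn ℝ ∞ f (Ioi 0) ∧
    ∀ N : ℕ, ∃ L : ℂ, Tendsto (iteratedDeriv N f) (𝓝[>] (0 : ℝ)) (𝓝 L)

/-- The space `𝒮([0,∞))`: `f ∈ C^∞([0,∞))` and every `x^M f^(N)(x)` is bounded. -/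
def IsSchwartzHalfLine (f : ℝ → ℂ) : Prop :=
  IsSmoothHalfLine f ∧
    ∀ M N : ℕ, ∃ C : ℝ, ∀ x : ℝ, 0 < x → ‖(x : ℂ) ^ M * iteratedDeriv N f x‖ ≤ C

/-- The half-line Fourier transform `û₀(lam) = ∫_0^∞ u₀(x) e^{-i lam x} dx` (for `Im lam ≤ 0`). -/
def halfLineFourier (u₀ : ℝ → ℂ) (lam : ℂ) : ℂ :=
  ∫ x in Ioi (0 : ℝ), u₀ x * Complex.exp (-Complex.I * lam * x)

/-- The transform `g̃₀(lam, t) = ∫_0^t e^{lam² τ} g₀(τ) dτ`. -/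
def boundaryTransform (g₀ : ℝ → ℂ) (lam : ℂ) (t : ℝ) : ℂ :=
  ∫ τ in (0 : ℝ)..t, Complex.exp (lam ^ 2 * τ) * g₀ τ

/-- The integral of `f` over the contour `Γ = {lam : Im lam ≥ 0, Re (lam²) = 0}`, the positively
oriented boundary of `{lam : Im lam ≥ 0, Re (lam²) ≤ 0}`: it comes in from infinity along the ray
`arg lam = 3π/4` to the origin and goes out to infinity along the ray `arg lam = π/4`. -/
def integralGamma (f : ℂ → ℂ) : ℂ :=
  (∫ r in Ioi (0 : ℝ), f (r * Complex.exp (Real.pi / 4 * Complex.I)) *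
      Complex.exp (Real.pi / 4 * Complex.I)) -
    ∫ r in Ioi (0 : ℝ), f (r * Complex.exp (3 * Real.pi / 4 * Complex.I)) *
      Complex.exp (3 * Real.pi / 4 * Complex.I)

/-- The function given by the Fokas integral representation for the heat equation on the half line
with initial datum `u₀` and Dirichlet datum `g₀` (meaningful for `x > 0`, `t > 0`). -/
def fokasSolution (u₀ g₀ : ℝ → ℂ) (x t : ℝ) : ℂ :=
  1 / (2 * Real.pi) *
      (∫ lam : ℝ, Complex.exp (Complex.I * lam * x - (lam : ℂ) ^ 2 * t) * halfLineFourier u₀ lam)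
    - 1 / (2 * Real.pi) *
      integralGamma (fun lam =>
        Complex.exp (Complex.I * lam * x - lam ^ 2 * t) * halfLineFourier u₀ (-lam))
    - Complex.I / Real.pi *
      integralGamma (fun lam =>
        Complex.exp (Complex.I * lam * x - lam ^ 2 * t) * lam * boundaryTransform g₀ lam t)

/-- The open quadrant `Q = {(x,t) : x > 0, t > 0}`. -/
def openQuadrant : Set (ℝ × ℝ) := {p | 0 < p.1 ∧ 0 < p.2}

/-- The closed quadrant without its corner, `{(x,t) : x ≥ 0, t ≥ 0} \ {(0,0)}`. -/
def puncturedClosedQuadrant : Set (ℝ × ℝ) := {p | 0 ≤ p.1 ∧ 0 ≤ p.2} \ {(0, 0)}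

/-- The mixed partial derivative `∂^{k+l} u / ∂x^k ∂t^l` at the point `(x,t)`. -/
def mixedPartial (k l : ℕ) (u : ℝ → ℝ → ℂ) (x t : ℝ) : ℂ :=
  iteratedDeriv k (fun y => iteratedDeriv l (fun s => u y s) t) x

end

/-!
# Smoothness of the Fokas solution of the heat equation up to the boundary

On `Γ` and on the real line the elementary solution `e^{iλx - λ²s}` (`heatWave`) has explicit integrals.
Rotating the rays of `Γ` (`integralRay_heatWave_eq`) to the real line for `s > 0`, and into each other
for `s < 0`, turns the three terms of the Fokas formula (`fokasSolution_eq`) into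
`A(x,t) - A(-x,t) + B(x,t)`, where `A` is the heat flow on the line of the initial datum extended by
zero (`lineHeat`), and `B` is the potential of the boundary datum against the Poisson kernel
`(4π)^{-1/2} x s^{-3/2} e^{-x²/4s}` (`layerHeat`).

Two facts give smoothness up to the boundary.

* Extended by zero to `s ≤ 0`, the kernels are smooth on `ℝ² \ {0}` (`contDiffAt_heatPow`). So a part
  of a datum that is supported away from the boundary point under consideration contributes a smooth
  function there, however rough it is.
* The remaining part of the datum is a Schwartz function on the whole line, obtained by a cutoff. Its
  Fourier transform decays rapidly, and its contribution is a superposition of damped waves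
  `e^{i a} e^{-b}` with phases `a` and damping rates `b` linear in `(x,t)`, and `b ≥ 0` in the closed
  quadrant. Replacing `e^{-b}` by a function with bounded derivatives that agrees with it for `b ≥ 0`
  (`cutExp`) makes the superposition smooth on all of `ℝ²` (`contDiff_integral_cutWave`). For the
  initial datum this is the Fourier integral over the real line, for the boundary datum the integral
  over `Γ`, where `λ² = ± i r²` makes the boundary transform a Fourier transform.

The local extensions obtained in this way (`smoothlyExtendsAt_fokasSolution`) agree at the boundary,
because the open quadrant is dense, and the mixed partial derivatives are obtained by differentiating
the extension within the closed quadrant.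
-/

/-! ### Smoothness of integrals with linear phases -/

section Sandwich

variable {E F G H : Type} [NormedAddCommGroup E] [NormedSpace ℝ E] [NormedAddCommGroup F]
  [NormedSpace ℝ F] [NormedAddCommGroup G] [NormedSpace ℝ G] [NormedAddCommGroup H]
  [NormedSpace ℝ H]

/-- The operator `L ↦ T ∘ L ∘ M` on continuous linear maps. -/
noncomputable def clmSandwich (T : G →L[ℝ] H) (M : E →L[ℝ] F) : (F →L[ℝ] G) →L[ℝ] (E →L[ℝ] H) :=
  (ContinuousLinearMap.compL ℝ E G H T).comp ((ContinuousLinearMap.compL ℝ E F G).flip M)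

theorem norm_clm_comp_comp_le (T : G →L[ℝ] H) (M : E →L[ℝ] F) (L : F →L[ℝ] G) :
    ‖T.comp (L.comp M)‖ ≤ ‖T‖ * ‖M‖ * ‖L‖ := by
  calc ‖T.comp (L.comp M)‖ ≤ ‖T‖ * (‖L‖ * ‖M‖) :=
        (ContinuousLinearMap.opNorm_comp_le _ _).trans
          (by gcongr; exact ContinuousLinearMap.opNorm_comp_le _ _)
    _ = ‖T‖ * ‖M‖ * ‖L‖ := by ring

theorem norm_clmSandwich_le (T : G →L[ℝ] H) (M : E →L[ℝ] F) :
    ‖clmSandwich T M‖ ≤ ‖T‖ * ‖M‖ :=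
  ContinuousLinearMap.opNorm_le_bound _ (by positivity) fun L => norm_clm_comp_comp_le T M L

theorem continuous_clmSandwich :
    Continuous fun x : (G →L[ℝ] H) × (E →L[ℝ] F) => clmSandwich x.1 x.2 :=
  isBoundedBilinearMap_comp.continuous.comp
    (((ContinuousLinearMap.compL ℝ E G H).continuous.comp continuous_fst).prodMk
      ((ContinuousLinearMap.compL ℝ E F G).flip.continuous.comp continuous_snd))

end Sandwich

/-- Smoothness of integrals `p ↦ ∫ T(w) (Φ (M(w) p))`, with `Φ` smooth with bounded derivatives and
`T(w)`, `M(w)` linear. Differentiation reproduces this form, with `fderiv ℝ Φ` in place of `Φ` and one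
more factor `M(w)` in the coefficient `T(w)`, so the proof is an induction over all target spaces. -/
theorem contDiff_integral_clm_comp {Ω : Type} [MeasurableSpace Ω] {μ : Measure Ω}
    {E F : Type} [NormedAddCommGroup E] [NormedSpace ℝ E] [NormedAddCommGroup F] [NormedSpace ℝ F]
    {M : Ω → E →L[ℝ] F} (hM : AEStronglyMeasurable M μ) (n : ℕ) :
    ∀ {G H : Type} [NormedAddCommGroup G] [NormedSpace ℝ G] [NormedAddCommGroup H]
      [NormedSpace ℝ H] {T : Ω → G →L[ℝ] H} {Φ : F → G},
      AEStronglyMeasurable T μ → (∀ k : ℕ, Integrable (fun w => ‖T w‖ * ‖M w‖ ^ k) μ) →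
      ContDiff ℝ ∞ Φ → (∀ k : ℕ, ∃ C : ℝ, ∀ v, ‖iteratedFDeriv ℝ k Φ v‖ ≤ C) →
      ContDiff ℝ n (fun p => ∫ w, T w (Φ (M w p)) ∂μ) := by
  have key : ∀ {G H : Type} [NormedAddCommGroup G] [NormedSpace ℝ G] [NormedAddCommGroup H]
      [NormedSpace ℝ H] {T : Ω → G →L[ℝ] H} {Φ : F → G},
      AEStronglyMeasurable T μ → (∀ k : ℕ, Integrable (fun w => ‖T w‖ * ‖M w‖ ^ k) μ) →
      ContDiff ℝ ∞ Φ → (∀ k : ℕ, ∃ C : ℝ, ∀ v, ‖iteratedFDeriv ℝ k Φ v‖ ≤ C) → ∀ p : E,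
      HasFDerivAt (fun p => ∫ w, T w (Φ (M w p)) ∂μ)
        (∫ w, clmSandwich (T w) (M w) (fderiv ℝ Φ (M w p)) ∂μ) p := by
    intro G H _ _ _ _ T Φ hT hint hΦ hb p
    obtain ⟨C₀, hC₀⟩ := hb 0
    obtain ⟨C₁, hC₁⟩ := hb 1
    have hMp : ∀ q, AEStronglyMeasurable (fun w => M w q) μ := fun q =>
      (ContinuousLinearMap.apply ℝ F q).continuous.comp_aestronglyMeasurable hM
    have hmeas : ∀ q, AEStronglyMeasurable (fun w => T w (Φ (M w q))) μ := fun q =>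
      (isBoundedBilinearMap_apply (𝕜 := ℝ) (E := G) (F := H)).continuous.comp_aestronglyMeasurable
        (hT.prodMk (hΦ.continuous.comp_aestronglyMeasurable (hMp q)))
    have hd : Continuous (fderiv ℝ Φ) := hΦ.continuous_fderiv (by simp)
    refine hasFDerivAt_integral_of_dominated_of_fderiv_le (𝕜 := ℝ) (s := univ)
      (F' := fun q w => clmSandwich (T w) (M w) (fderiv ℝ Φ (M w q)))
      (bound := fun w => C₁ * (‖T w‖ * ‖M w‖ ^ 1)) univ_mem
      (Eventually.of_forall hmeas) ?_ ?_ ?_ ((hint 1).const_mul _) ?_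
    · refine ((hint 0).const_mul C₀).mono' (hmeas p) (Eventually.of_forall fun w => ?_)
      have h := hC₀ (M w p)
      rw [norm_iteratedFDeriv_zero] at h
      calc ‖T w (Φ (M w p))‖ ≤ ‖T w‖ * ‖Φ (M w p)‖ := (T w).le_opNorm _
        _ ≤ ‖T w‖ * C₀ := by gcongr
        _ = C₀ * (‖T w‖ * ‖M w‖ ^ 0) := by ring
    · have h1 : AEStronglyMeasurable (fun w => (fderiv ℝ Φ (M w p)).comp (M w)) μ :=
        isBoundedBilinearMap_comp.continuous.comp_aestronglyMeasurable
          ((hd.comp_aestronglyMeasurable (hMp p)).prodMk hM)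
      exact isBoundedBilinearMap_comp.continuous.comp_aestronglyMeasurable (hT.prodMk h1)
    · refine Eventually.of_forall fun w q _ => ?_
      have h := hC₁ (M w q)
      rw [norm_iteratedFDeriv_one] at h
      calc ‖(T w).comp ((fderiv ℝ Φ (M w q)).comp (M w))‖
          ≤ ‖T w‖ * ‖M w‖ * ‖fderiv ℝ Φ (M w q)‖ := norm_clm_comp_comp_le _ _ _
        _ ≤ ‖T w‖ * ‖M w‖ * C₁ := by gcongr
        _ = C₁ * (‖T w‖ * ‖M w‖ ^ 1) := by ring
    · refine Eventually.of_forall fun w q _ => ?_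
      have h1 : HasFDerivAt Φ (fderiv ℝ Φ (M w q)) (M w q) :=
        (hΦ.differentiable (by simp) _).hasFDerivAt
      exact (T w).hasFDerivAt.comp q (h1.comp q (M w).hasFDerivAt)
  induction n with
  | zero =>
    intro G H _ _ _ _ T Φ hT hint hΦ hb
    exact contDiff_zero.2 (continuous_iff_continuousAt.2 fun p =>
      (key hT hint hΦ hb p).continuousAt)
  | succ n ih =>
    intro G H _ _ _ _ T Φ hT hint hΦ hb
    refine contDiff_succ_iff_hasFDerivAt.2 ⟨_, ?_, key hT hint hΦ hb⟩
    refine ih ?_ ?_ (hΦ.fderiv_right (by simp)) fun k => ?_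
    · exact continuous_clmSandwich.comp_aestronglyMeasurable (hT.prodMk hM)
    · intro k
      refine (hint (k + 1)).mono' ?_ (Eventually.of_forall fun w => ?_)
      · exact (continuous_clmSandwich.comp_aestronglyMeasurable (hT.prodMk hM)).norm.mul
          (hM.norm.pow k)
      · rw [Real.norm_of_nonneg (by positivity), pow_succ', ← mul_assoc]
        gcongr
        exact norm_clmSandwich_le _ _
    · obtain ⟨C, hC⟩ := hb (k + 1)
      exact ⟨C, fun v => by rw [norm_iteratedFDeriv_fderiv]; exact hC v⟩

/-! ### Smoothness of integrals over compact sets -/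

theorem exists_contDiff_cutoff {k V : Set ℝ} (hk : IsCompact k) (hV : IsOpen V) (hkV : k ⊆ V) :
    ∃ (c : ℝ → ℝ) (k' : Set ℝ), ContDiff ℝ ∞ c ∧ IsCompact k' ∧ k' ⊆ V ∧ (∀ y ∈ k, c y = 1) ∧
      ∀ y ∉ k', c y = 0 := by
  obtain ⟨k', hk', h1, h2⟩ := exists_compact_between hk hV hkV
  obtain ⟨f, hf1, hf0, -⟩ := exists_contMDiffMap_one_nhds_of_subset_interior (n := ⊤)
    (modelWithCornersSelf ℝ ℝ) hk.isClosed h1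
  exact ⟨f, k', f.contMDiff.contDiff, hk', h2, fun y hy => hf1.self_of_nhdsSet _ hy, hf0⟩

/-- An integral against a compactly supported integrable function `f` depends smoothly on a parameter
as soon as the kernel is smooth near `{p₀} × supp f`. The integral is the value at `0` of a convolution
with a parameter-dependent kernel, once the kernel is cut off near the support of `f`. -/
theorem contDiffAt_integral_mul_of_compact {P : Type} [NormedAddCommGroup P] [NormedSpace ℝ P]
    {F : P × ℝ → ℂ} {W : Set (P × ℝ)} (hW : IsOpen W) (hF : ContDiffOn ℝ ∞ F W)
    {f : ℝ → ℂ} (hf : Integrable f) {k : Set ℝ} (hk : IsCompact k) (hfk : ∀ y ∉ k, f y = 0)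
    {p₀ : P} (hp : ∀ y ∈ k, (p₀, y) ∈ W) :
    ContDiffAt ℝ ∞ (fun p => ∫ y, f y * F (p, y)) p₀ := by
  obtain ⟨s, V, hs, hV, hps, hkV, hsV⟩ := generalized_tube_lemma (isCompact_singleton (x := p₀)) hk
    hW (by rintro ⟨p, y⟩ ⟨rfl, h2⟩; exact hp y h2)
  obtain ⟨c, k', hc, hk', hk'V, hc1, hc0⟩ := exists_contDiff_cutoff hk hV hkV
  let g : P → ℝ → ℂ := fun p y => (c (-y) : ℂ) * F (p, -y)
  have hg : ContDiffOn ℝ ∞ ↿g (s ×ˢ univ) := by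
    rintro ⟨p, y⟩ ⟨h1, -⟩
    refine ContDiffAt.contDiffWithinAt ?_
    by_cases hy : -y ∈ k'
    · have hFy : ContDiffAt ℝ ∞ F (p, -y) :=
        hF.contDiffAt (hW.mem_nhds (hsV ⟨h1, hk'V hy⟩))
      have h2 : ContDiffAt ℝ ∞ (fun q : P × ℝ => F (q.1, -q.2)) (p, y) :=
        ContDiffAt.comp (p, y) (g := F) (f := fun q : P × ℝ => (q.1, -q.2)) hFy
          (contDiffAt_fst.prodMk contDiffAt_snd.neg)
      have h3 : ContDiff ℝ ∞ (fun q : P × ℝ => (c (-q.2) : ℂ)) :=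
        Complex.ofRealCLM.contDiff.comp (hc.comp contDiff_snd.neg)
      exact h3.contDiffAt.mul h2
    · have : ↿g =ᶠ[𝓝 (p, y)] fun _ => 0 := by
        have ho : IsOpen {q : P × ℝ | -q.2 ∉ k'} :=
          hk'.isClosed.isOpen_compl.preimage (by fun_prop)
        filter_upwards [ho.mem_nhds hy] with q hq
        change (c (-q.2) : ℂ) * F (q.1, -q.2) = 0
        rw [hc0 _ hq, Complex.ofReal_zero, zero_mul]
      exact contDiffAt_const.congr_of_eventuallyEq this
  have hconv := contDiffOn_convolution_right_with_param (n := ⊤) (k := -k')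
    (ContinuousLinearMap.mul ℝ ℂ) (μ := volume) hs hk'.neg (fun p y _ hy => by
      have : c (-y) = 0 := hc0 _ (by simpa using hy)
      simp [g, this]) hf.locallyIntegrable hg
  have h4 : ContDiffOn ℝ ∞ (fun p => ∫ y, f y * F (p, y)) s := by
    have h5 := hconv.comp (s := s) (f := fun p => (p, (0 : ℝ)))
      (contDiff_id.prodMk contDiff_const).contDiffOn (fun p hp => ⟨hp, mem_univ _⟩)
    refine h5.congr fun p _ => ?_
    simp only [Function.comp, convolution_def]
    refine integral_congr_ae (Eventually.of_forall fun y => ?_)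
    by_cases hy : y ∈ k
    · simp [g, hc1 y hy]
    · simp [hfk y hy]
  exact h4.contDiffAt (hs.mem_nhds (hps rfl))

/-! ### Smoothness of the heat kernel away from the origin -/

/-- The function `s ↦ s⁻ᵃ e^{-1/s}` on `(0,∞)`, extended by zero. -/
noncomputable def rpowNegMulExpNegInv (a s : ℝ) : ℝ :=
  if 0 < s then s ^ (-a) * Real.exp (-s⁻¹) else 0

theorem tendsto_rpowNegMulExpNegInv_zero (a : ℝ) :
    Tendsto (rpowNegMulExpNegInv a) (𝓝 0) (𝓝 0) := by
  have h1 : Tendsto (rpowNegMulExpNegInv a) (𝓝[>] 0) (𝓝 0) := by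
    have h := (tendsto_rpow_mul_exp_neg_mul_atTop_nhds_zero a 1 one_pos).comp
      (tendsto_inv_nhdsGT_zero (𝕜 := ℝ))
    refine h.congr' ?_
    filter_upwards [self_mem_nhdsWithin] with s hs
    have hs : 0 < s := hs
    simp [rpowNegMulExpNegInv, hs, Real.rpow_neg hs.le, Real.inv_rpow hs.le]
  have h2 : Tendsto (rpowNegMulExpNegInv a) (𝓝[≤] 0) (𝓝 0) := by
    refine tendsto_const_nhds.congr' ?_
    filter_upwards [self_mem_nhdsWithin] with s hs
    rw [rpowNegMulExpNegInv, if_neg (not_lt.2 hs)]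
  exact (h2.sup h1).mono_left (nhdsLE_sup_nhdsGT 0).ge

/-- The family `rpowNegMulExpNegInv` is closed under differentiation up to linear combinations, also
at the gluing point `s = 0`. -/
theorem hasDerivAt_rpowNegMulExpNegInv (a s : ℝ) :
    HasDerivAt (rpowNegMulExpNegInv a)
      (-a * rpowNegMulExpNegInv (a + 1) s + rpowNegMulExpNegInv (a + 2) s) s := by
  rcases lt_trichotomy s 0 with hs | rfl | hs
  · have h0 : ∀ b, rpowNegMulExpNegInv b s = 0 := fun b => if_neg (not_lt.2 hs.le)
    rw [h0, h0, mul_zero, add_zero]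
    refine (hasDerivAt_const s (0 : ℝ)).congr_of_eventuallyEq ?_
    filter_upwards [gt_mem_nhds hs] with r hr
    exact if_neg (not_lt.2 hr.le)
  · have h0 : ∀ b, rpowNegMulExpNegInv b 0 = 0 := fun b => if_neg (lt_irrefl _)
    rw [h0, h0, mul_zero, add_zero, hasDerivAt_iff_tendsto_slope]
    refine ((tendsto_rpowNegMulExpNegInv_zero (a + 1)).mono_left nhdsWithin_le_nhds).congr' ?_
    filter_upwards [self_mem_nhdsWithin] with s hs
    rw [slope_def_field, h0, sub_zero, sub_zero]
    by_cases hs' : 0 < s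
    · rw [rpowNegMulExpNegInv, rpowNegMulExpNegInv, if_pos hs', if_pos hs', neg_add,
        Real.rpow_add hs', Real.rpow_neg_one]
      ring
    · rw [rpowNegMulExpNegInv, rpowNegMulExpNegInv, if_neg hs', if_neg hs', zero_div]
  · have h1 : HasDerivAt (fun s => s ^ (-a) * Real.exp (-s⁻¹))
        (-a * s ^ (-a - 1) * Real.exp (-s⁻¹) + s ^ (-a) * (Real.exp (-s⁻¹) * (- -(s ^ 2)⁻¹))) s :=
      (Real.hasDerivAt_rpow_const (Or.inl hs.ne')).mul (hasDerivAt_inv hs.ne').neg.exp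
    have h2 := h1.congr_of_eventuallyEq (f₁ := rpowNegMulExpNegInv a) (by
      filter_upwards [lt_mem_nhds hs] with r hr
      exact if_pos hr)
    convert! h2 using 1
    rw [rpowNegMulExpNegInv, rpowNegMulExpNegInv, if_pos hs, if_pos hs,
      show -(a + 1) = -a - 1 by ring, show -(a + 2) = -a - 2 by ring, Real.rpow_sub hs _ 2]
    rw [Real.rpow_two]
    field_simp

theorem contDiff_rpowNegMulExpNegInv (a : ℝ) : ContDiff ℝ ∞ (rpowNegMulExpNegInv a) := by
  rw [contDiff_infty]
  intro n
  induction n generalizing a with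
  | zero =>
    exact contDiff_zero.2 (continuous_iff_continuousAt.2 fun s =>
      (hasDerivAt_rpowNegMulExpNegInv a s).continuousAt)
  | succ n ih =>
    push_cast
    refine contDiff_succ_iff_deriv.2 ⟨fun s => (hasDerivAt_rpowNegMulExpNegInv a s).differentiableAt,
      by simp, ?_⟩
    rw [funext fun s => (hasDerivAt_rpowNegMulExpNegInv a s).deriv]
    exact (contDiff_const.mul (ih _)).add (ih _)

/-- The function `(z, s) ↦ s⁻ᵃ e^{-z²/(4s)}` for `s > 0`, extended by zero to `s ≤ 0`. Up to factors,
`a = 1/2` is the heat kernel, and `a = 3/2` its normal derivative. -/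
noncomputable def heatPow (a : ℝ) (q : ℝ × ℝ) : ℝ :=
  if 0 < q.2 then q.2 ^ (-a) * Real.exp (-(q.1 ^ 2 / (4 * q.2))) else 0

theorem heatPow_eq_rpowNegMulExpNegInv (a : ℝ) {q : ℝ × ℝ} (hq : q.1 ≠ 0) :
    heatPow a q = rpowNegMulExpNegInv a (4 * q.2 / q.1 ^ 2) * (4 / q.1 ^ 2) ^ a := by
  have h : 0 < q.1 ^ 2 := by positivity
  by_cases hs : 0 < q.2
  · have h2 : 0 < 4 * q.2 / q.1 ^ 2 := by positivity
    rw [heatPow, rpowNegMulExpNegInv, if_pos hs, if_pos h2, inv_div,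
      show 4 * q.2 / q.1 ^ 2 = q.2 * (4 / q.1 ^ 2) by ring,
      Real.mul_rpow hs.le (by positivity), Real.rpow_neg (x := 4 / q.1 ^ 2) (by positivity)]
    have : (4 / q.1 ^ 2) ^ a ≠ 0 := (Real.rpow_pos_of_pos (by positivity) _).ne'
    field_simp
  · have h2 : ¬ 0 < 4 * q.2 / q.1 ^ 2 := by
      rw [not_lt] at hs ⊢
      exact div_nonpos_of_nonpos_of_nonneg (by linarith) h.le
    rw [heatPow, rpowNegMulExpNegInv, if_neg hs, if_neg h2, zero_mul]

/-- Extended by zero to negative times, the heat kernel is smooth away from the origin of space-time.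
-/
theorem contDiffAt_heatPow (a : ℝ) {q : ℝ × ℝ} (hq : q ≠ 0) : ContDiffAt ℝ ∞ (heatPow a) q := by
  rcases ne_or_eq q.1 0 with hz | hz
  · have h1 : ContDiffAt ℝ ∞ (fun q : ℝ × ℝ =>
        rpowNegMulExpNegInv a (4 * q.2 / q.1 ^ 2) * (4 / q.1 ^ 2) ^ a) q := by
      have hz2 : q.1 ^ 2 ≠ 0 := pow_ne_zero 2 hz
      refine ((contDiff_rpowNegMulExpNegInv a).contDiffAt.comp q
        ((contDiffAt_const.mul contDiffAt_snd).div (contDiffAt_fst.pow 2) hz2)).mul ?_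
      have h2 : ContDiffAt ℝ ∞ (fun q : ℝ × ℝ => 4 / q.1 ^ 2) q :=
        contDiffAt_const.div (contDiffAt_fst.pow 2) hz2
      exact h2.rpow_const_of_ne (by positivity)
    refine h1.congr_of_eventuallyEq ?_
    filter_upwards [(isOpen_ne.preimage continuous_fst).mem_nhds hz] with r hr
    exact heatPow_eq_rpowNegMulExpNegInv a hr
  · have hs : q.2 ≠ 0 := fun h => hq (Prod.ext hz h)
    rcases hs.lt_or_gt with hs | hs
    · refine (contDiffAt_const (c := (0 : ℝ))).congr_of_eventuallyEq ?_
      filter_upwards [(isOpen_Iio.preimage continuous_snd).mem_nhds hs] with r hr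
      exact if_neg (not_lt.2 (le_of_lt hr))
    · have h1 : ContDiffAt ℝ ∞ (fun q : ℝ × ℝ =>
          q.2 ^ (-a) * Real.exp (-(q.1 ^ 2 / (4 * q.2)))) q := by
        refine (contDiffAt_snd.rpow_const_of_ne hs.ne').mul (ContDiffAt.exp ?_)
        exact ((contDiffAt_fst.pow 2).div (contDiffAt_const.mul contDiffAt_snd)
          (by positivity)).neg
      refine h1.congr_of_eventuallyEq ?_
      filter_upwards [(isOpen_Ioi.preimage continuous_snd).mem_nhds hs] with r hr
      exact if_pos hr

/-! ### Damped waves with a cutoff -/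

/-- A smooth function on `ℝ` equal to `e^{-s}` for `s ≥ 0`, all of whose derivatives are bounded
(the exponential is cut off to the left of `-1`). -/
noncomputable def cutExp (s : ℝ) : ℂ := ((Real.smoothTransition (s + 1) * Real.exp (-s) : ℝ) : ℂ)

theorem cutExp_of_nonneg {s : ℝ} (hs : 0 ≤ s) : cutExp s = Complex.exp (-s) := by
  rw [cutExp, Real.smoothTransition.one_of_one_le (by linarith), one_mul]
  push_cast
  rfl

theorem contDiff_cutExp : ContDiff ℝ ∞ cutExp :=
  Complex.ofRealCLM.contDiff.comp
    ((Real.smoothTransition.contDiff.comp (contDiff_id.add contDiff_const)).mul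
      (Real.contDiff_exp.comp contDiff_neg))

theorem iteratedDeriv_cexp_const_mul_ofReal (n : ℕ) (c : ℂ) (s : ℝ) :
    iteratedDeriv n (fun s : ℝ => Complex.exp (c * s)) s = c ^ n * Complex.exp (c * s) := by
  induction n generalizing s with
  | zero => simp
  | succ n ih =>
    rw [iteratedDeriv_succ, funext ih]
    have h : HasDerivAt (fun s : ℝ => c * (s : ℂ)) c s := by
      simpa using (Complex.ofRealCLM.hasDerivAt (x := s)).const_mul c
    rw [(h.cexp.const_mul _).deriv]
    ring

theorem exists_bound_iteratedFDeriv_cutExp (n : ℕ) :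
    ∃ C : ℝ, ∀ s, ‖iteratedFDeriv ℝ n cutExp s‖ ≤ C := by
  have hc : Continuous fun s => ‖iteratedFDeriv ℝ n cutExp s‖ :=
    (contDiff_cutExp.continuous_iteratedFDeriv (by exact_mod_cast le_top)).norm
  obtain ⟨C, hC⟩ := (isCompact_Icc (a := (-1 : ℝ)) (b := 0)).bddAbove_image hc.continuousOn
  refine ⟨max C 1, fun s => ?_⟩
  by_cases h1 : s < -1
  · have : cutExp =ᶠ[𝓝 s] fun _ => 0 := by
      filter_upwards [gt_mem_nhds h1] with r hr
      rw [cutExp, Real.smoothTransition.zero_of_nonpos (by linarith)]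
      simp
    rw [this.iteratedFDeriv ℝ n |>.eq_of_nhds]
    rw [norm_iteratedFDeriv_eq_norm_iteratedDeriv, iteratedDeriv_const]
    split_ifs <;> simp
  by_cases h2 : 0 < s
  · have : cutExp =ᶠ[𝓝 s] fun r : ℝ => Complex.exp (-1 * r) := by
      filter_upwards [lt_mem_nhds h2] with r hr
      rw [cutExp_of_nonneg hr.le, neg_one_mul]
    rw [this.iteratedFDeriv ℝ n |>.eq_of_nhds, norm_iteratedFDeriv_eq_norm_iteratedDeriv,
      iteratedDeriv_cexp_const_mul_ofReal]
    refine le_trans ?_ (le_max_right _ _)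
    rw [norm_mul, norm_pow, norm_neg, norm_one, one_pow, one_mul, Complex.norm_exp]
    simpa using h2.le
  · exact le_trans (hC ⟨s, ⟨not_lt.1 h1, not_lt.1 h2⟩, rfl⟩) (le_max_left _ _)

theorem exists_bound_iteratedFDeriv_cexp_I (n : ℕ) :
    ∃ C : ℝ, ∀ s, ‖iteratedFDeriv ℝ n (fun s : ℝ => Complex.exp (Complex.I * s)) s‖ ≤ C := by
  refine ⟨1, fun s => ?_⟩
  rw [norm_iteratedFDeriv_eq_norm_iteratedDeriv, iteratedDeriv_cexp_const_mul_ofReal, norm_mul,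
    norm_pow, Complex.norm_I, one_pow, one_mul, Complex.norm_exp]
  simp

theorem exists_bound_iteratedFDeriv_comp_clm {E F G : Type} [NormedAddCommGroup E]
    [NormedSpace ℝ E] [NormedAddCommGroup F] [NormedSpace ℝ F] [NormedAddCommGroup G]
    [NormedSpace ℝ G] {f : F → G} (hf : ContDiff ℝ ∞ f)
    (hb : ∀ n, ∃ C : ℝ, ∀ s, ‖iteratedFDeriv ℝ n f s‖ ≤ C) (g : E →L[ℝ] F) (n : ℕ) :
    ∃ C : ℝ, ∀ s, ‖iteratedFDeriv ℝ n (f ∘ g) s‖ ≤ C := by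
  obtain ⟨C, hC⟩ := hb n
  refine ⟨C * ∏ _i : Fin n, ‖g‖, fun s => ?_⟩
  rw [g.iteratedFDeriv_comp_right hf s (by exact_mod_cast le_top)]
  refine (ContinuousMultilinearMap.norm_compContinuousLinearMap_le _ _).trans ?_
  gcongr
  exact hC _

/-- The function `(a, b) ↦ e^{ia} e^{-b}`, cut off to the left of `b = -1`. -/
noncomputable def cutWave (v : ℝ × ℝ) : ℂ := Complex.exp (Complex.I * v.1) * cutExp v.2

theorem contDiff_cexp_I : ContDiff ℝ ∞ (fun s : ℝ => Complex.exp (Complex.I * s)) :=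
  (contDiff_const.mul Complex.ofRealCLM.contDiff).cexp

theorem contDiff_cutWave : ContDiff ℝ ∞ cutWave :=
  (contDiff_cexp_I.comp contDiff_fst).mul (contDiff_cutExp.comp contDiff_snd)

theorem exists_bound_iteratedFDeriv_cutWave (n : ℕ) :
    ∃ C : ℝ, ∀ v, ‖iteratedFDeriv ℝ n cutWave v‖ ≤ C := by
  choose A hA using exists_bound_iteratedFDeriv_comp_clm contDiff_cexp_I
    exists_bound_iteratedFDeriv_cexp_I (ContinuousLinearMap.fst ℝ ℝ ℝ)
  choose B hB using exists_bound_iteratedFDeriv_comp_clm contDiff_cutExp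
    exists_bound_iteratedFDeriv_cutExp (ContinuousLinearMap.snd ℝ ℝ ℝ)
  refine ⟨_, fun v => (norm_iteratedFDeriv_mul_le (N := ∞)
    (contDiff_cexp_I.comp (ContinuousLinearMap.fst ℝ ℝ ℝ).contDiff)
    (contDiff_cutExp.comp (ContinuousLinearMap.snd ℝ ℝ ℝ).contDiff) v
    (by exact_mod_cast le_top)).trans (Finset.sum_le_sum (fun i _ => ?_) (g := fun i =>
      (n.choose i : ℝ) * A i * B (n - i)))⟩
  have := (norm_nonneg _).trans (hA i v)
  exact mul_le_mul (mul_le_mul_of_nonneg_left (hA i v) (by positivity)) (hB _ v) (norm_nonneg _)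
    (by positivity)

/-- Superpositions of the waves `e^{i M₁(p)} e^{-M₂(p)}`, with linear phases and damping rates,
depend smoothly on `p`, provided that the amplitude decays faster than any power of `M`. The cutoff
makes the integral meaningful also where the damping rate `M₂(p)` is negative. -/
theorem contDiff_integral_cutWave {μ : Measure ℝ} {M : ℝ → ℝ × ℝ →L[ℝ] ℝ × ℝ}
    (hM : AEStronglyMeasurable M μ) {ψ : ℝ → ℂ} (hψ : AEStronglyMeasurable ψ μ)
    (hint : ∀ k : ℕ, Integrable (fun r => ‖ψ r‖ * ‖M r‖ ^ k) μ) :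
    ContDiff ℝ ∞ (fun p => ∫ r, ψ r * cutWave (M r p) ∂μ) := by
  rw [contDiff_infty]
  intro n
  exact contDiff_integral_clm_comp hM n (T := fun r => ContinuousLinearMap.mul ℝ ℂ (ψ r))
    ((ContinuousLinearMap.mul ℝ ℂ).continuous.comp_aestronglyMeasurable hψ)
    (by simpa using hint) contDiff_cutWave exists_bound_iteratedFDeriv_cutWave

/-! ### Contour integrals of the elementary solutions -/

/-- The elementary solution `e^{iλx - λ²s}` of the heat equation. -/
noncomputable def heatWave (x s : ℝ) (lam : ℂ) : ℂ := Complex.exp (Complex.I * lam * x - lam ^ 2 * s)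

theorem continuous_heatWave (x s : ℝ) : Continuous (heatWave x s) := by
  unfold heatWave; fun_prop

theorem hasDerivAt_heatWave (x s : ℝ) (lam : ℂ) :
    HasDerivAt (heatWave x s) ((Complex.I * x - 2 * lam * s) * heatWave x s lam) lam := by
  have h : HasDerivAt (fun l : ℂ => Complex.I * l * x - l ^ 2 * s)
      (Complex.I * x - 2 * lam * s) lam := by
    have h1 := (((hasDerivAt_id lam).const_mul Complex.I).mul_const (x : ℂ)).sub
      (((hasDerivAt_id lam).pow 2).mul_const (s : ℂ))
    convert! h1 using 1
    simp
  rw [mul_comm]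
  exact h.cexp

theorem norm_heatWave_ray (x s r θ : ℝ) :
    ‖heatWave x s (r * Complex.exp (θ * Complex.I))‖ =
      Real.exp (-(x * r * Real.sin θ + s * r ^ 2 * Real.cos (2 * θ))) := by
  rw [heatWave, Complex.norm_exp, Complex.exp_mul_I, Real.cos_two_mul']
  congr 1
  simp [pow_two, Complex.cos_ofReal_re, Complex.sin_ofReal_re]
  ring

/-- Exponential decay along all rays of the sector `{sin θ ≥ 0, s cos 2θ ≥ 0}`, uniformly in `θ`. -/
theorem norm_heatWave_ray_le {x s θ r : ℝ} (hx : 0 < x) (hs : s ≠ 0) (hr : 0 ≤ r)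
    (h1 : 0 ≤ Real.sin θ) (h2 : 0 ≤ s * Real.cos (2 * θ)) :
    ‖heatWave x s (r * Complex.exp (θ * Complex.I))‖ ≤
      Real.exp (x ^ 2 / (8 * |s|)) * Real.exp (-(x / 2 * r)) := by
  rw [norm_heatWave_ray, ← Real.exp_add, Real.exp_le_exp]
  have hs' : 0 < |s| := abs_pos.2 hs
  have h3 : 0 ≤ x ^ 2 / (8 * |s|) := by positivity
  -- for large `sin θ` the factor `e^{iλx}` decays; for small `sin θ` one has `cos 2θ ≥ 1/2`, so that
  -- `s > 0` and the Gaussian factor decays, with a constant found by completing the square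
  by_cases h : 1 / 2 ≤ Real.sin θ
  · have h4 : x * r * (1 / 2) ≤ x * r * Real.sin θ := by gcongr
    have h5 : 0 ≤ s * Real.cos (2 * θ) * r ^ 2 := by positivity
    linarith
  · have h4 : 1 / 2 ≤ Real.cos (2 * θ) := by
      rw [Real.cos_two_mul', Real.cos_sq']
      nlinarith
    have hs0 : 0 < s := by
      by_contra hneg
      have : s * Real.cos (2 * θ) < 0 :=
        mul_neg_of_neg_of_pos (lt_of_le_of_ne (not_lt.1 hneg) hs) (by linarith)
      linarith
    rw [abs_of_pos hs0]
    have h5 : s * r ^ 2 * (1 / 2) ≤ s * r ^ 2 * Real.cos (2 * θ) := by gcongr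
    have h6 : 0 ≤ x * r * Real.sin θ := by positivity
    have h7 : x ^ 2 / (8 * s) - x / 2 * r + s * r ^ 2 * (1 / 2) = s / 2 * (r - x / (2 * s)) ^ 2 := by
      field_simp
      ring
    have h8 : 0 ≤ s / 2 * (r - x / (2 * s)) ^ 2 := by positivity
    linarith

theorem integrableOn_pow_mul_exp_neg (k : ℕ) {c : ℝ} (hc : 0 < c) :
    IntegrableOn (fun r : ℝ => r ^ k * Real.exp (-(c * r))) (Ioi 0) := by
  have h := integrableOn_rpow_mul_exp_neg_mul_rpow (p := 1) (s := k) (b := c)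
    (by have : (0 : ℝ) ≤ k := k.cast_nonneg
        linarith) one_pos hc
  refine h.congr_fun (fun r _ => ?_) measurableSet_Ioi
  simp

/-- The integral of `f` along the ray of argument `θ`, directed away from the origin. -/
noncomputable def integralRay (θ : ℝ) (f : ℂ → ℂ) : ℂ :=
  ∫ r in Ioi (0 : ℝ), f (r * Complex.exp (θ * Complex.I)) * Complex.exp (θ * Complex.I)

theorem integralGamma_eq (f : ℂ → ℂ) :
    integralGamma f = integralRay (Real.pi / 4) f - integralRay (3 * Real.pi / 4) f := by
  simp [integralGamma, integralRay]

theorem norm_ray {r : ℝ} (hr : 0 ≤ r) (θ : ℝ) : ‖(r : ℂ) * Complex.exp (θ * Complex.I)‖ = r := by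
  rw [norm_mul, Complex.norm_exp_ofReal_mul_I, mul_one, Complex.norm_real, Real.norm_of_nonneg hr]

theorem integrableOn_ray_heatWave (j : ℕ) {x s θ : ℝ} (hx : 0 < x) (hs : s ≠ 0)
    (h1 : 0 ≤ Real.sin θ) (h2 : 0 ≤ s * Real.cos (2 * θ)) :
    IntegrableOn (fun r : ℝ => (r * Complex.exp (θ * Complex.I)) ^ j *
      heatWave x s (r * Complex.exp (θ * Complex.I))) (Ioi 0) := by
  refine ((integrableOn_pow_mul_exp_neg j (half_pos hx)).const_mul
    (Real.exp (x ^ 2 / (8 * |s|)))).mono' ?_ ?_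
  · have := continuous_heatWave x s
    exact Continuous.aestronglyMeasurable (by fun_prop)
  · refine ae_restrict_of_forall_mem measurableSet_Ioi fun r hr => ?_
    have hr' : 0 ≤ r := le_of_lt hr
    rw [norm_mul, norm_pow, norm_ray hr']
    calc r ^ j * ‖heatWave x s (r * Complex.exp (θ * Complex.I))‖
        ≤ r ^ j * (Real.exp (x ^ 2 / (8 * |s|)) * Real.exp (-(x / 2 * r))) := by
          gcongr; exact norm_heatWave_ray_le hx hs hr' h1 h2
      _ = _ := by ring

/-- The ray of integration can be rotated within the sector `{sin θ ≥ 0, s cos 2θ ≥ 0}`: the derivative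
of the integrand in the angle is a total derivative in the radius. The angle can be differentiated only
in the interior of the sector; the value at the boundary `θ = a` is reached by continuity. -/
theorem integralRay_heatWave_eq (j : ℕ) {x s a b : ℝ} (hx : 0 < x) (hs : s ≠ 0) (hab : a < b)
    (h : ∀ θ ∈ Icc a b, 0 ≤ Real.sin θ ∧ 0 ≤ s * Real.cos (2 * θ)) :
    integralRay a (fun lam => lam ^ j * heatWave x s lam) =
      integralRay b (fun lam => lam ^ j * heatWave x s lam) := by
  set f : ℂ → ℂ := fun lam => lam ^ j * heatWave x s lam with hf
  set f' : ℂ → ℂ := fun lam => (j * lam ^ (j - 1) * heatWave x s lam +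
    lam ^ j * ((Complex.I * x - 2 * lam * s) * heatWave x s lam)) with hf'
  have hff' : ∀ lam, HasDerivAt f (f' lam) lam := fun lam =>
    (hasDerivAt_pow j lam).mul (hasDerivAt_heatWave x s lam)
  have hw := continuous_heatWave x s
  have hfc : Continuous f := by rw [hf]; fun_prop
  have hf'c : Continuous f' := by rw [hf']; fun_prop
  set e : ℝ → ℂ := fun θ => Complex.exp (θ * Complex.I) with he
  have hec : Continuous e := by rw [he]; fun_prop
  have hen : ∀ θ, ‖e θ‖ = 1 := Complex.norm_exp_ofReal_mul_I
  have hed : ∀ θ, HasDerivAt e (e θ * Complex.I) θ := fun θ => by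
    have := ((Complex.ofRealCLM.hasDerivAt (x := θ)).mul_const Complex.I).cexp
    simpa [he] using this
  -- the common value of the derivative in the angle of the integrand and of the derivative in `r`
  -- of `i r e^{iθ} f(r e^{iθ})`
  set D : ℝ → ℝ → ℂ := fun θ r => f' (r * e θ) * (r * (e θ * Complex.I)) * e θ +
    f (r * e θ) * (e θ * Complex.I) with hD
  have hDc : Continuous (Function.uncurry D) := by
    rw [hD]; unfold Function.uncurry; fun_prop
  have hDθ : ∀ θ r : ℝ, HasDerivAt (fun θ => f (r * e θ) * e θ) (D θ r) θ := fun θ r =>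
    ((hff' _).comp θ ((hed θ).const_mul (r : ℂ))).mul (hed θ)
  have hDr : ∀ θ r : ℝ, HasDerivAt (fun r : ℝ => f (r * e θ) * (r * (e θ * Complex.I)))
      (D θ r) r := fun θ r => by
    have h1 : HasDerivAt (fun r : ℝ => (r : ℂ) * e θ) (e θ) r := by
      simpa using (Complex.ofRealCLM.hasDerivAt (x := r)).mul_const (e θ)
    have h2 : HasDerivAt (fun r : ℝ => (r : ℂ) * (e θ * Complex.I)) (e θ * Complex.I) r := by
      simpa using (Complex.ofRealCLM.hasDerivAt (x := r)).mul_const (e θ * Complex.I)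
    convert! (((hff' (r * e θ)).comp r h1).mul h2) using 1
    simp only [hD, Function.comp]
    ring
  set K := Real.exp (x ^ 2 / (8 * |s|))
  have hwb : ∀ θ ∈ Icc a b, ∀ r ∈ Ioi (0 : ℝ),
      ‖heatWave x s (r * e θ)‖ ≤ K * Real.exp (-(x / 2 * r)) := fun θ hθ r hr =>
    norm_heatWave_ray_le hx hs (le_of_lt hr) (h θ hθ).1 (h θ hθ).2
  have hnr : ∀ θ, ∀ r ∈ Ioi (0 : ℝ), ‖(r : ℂ) * e θ‖ = r := fun θ r hr => norm_ray (le_of_lt hr) θ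
  have hfb : ∀ θ ∈ Icc a b, ∀ r ∈ Ioi (0 : ℝ),
      ‖f (r * e θ)‖ ≤ K * (r ^ j * Real.exp (-(x / 2 * r))) := fun θ hθ r hr => by
    have hr' : (0 : ℝ) < r := hr
    simp only [hf]
    rw [norm_mul, norm_pow, hnr θ r hr]
    calc r ^ j * ‖heatWave x s (r * e θ)‖ ≤ r ^ j * (K * Real.exp (-(x / 2 * r))) := by
          gcongr; exact hwb θ hθ r hr
      _ = _ := by ring
  have hDb : ∀ θ ∈ Icc a b, ∀ r ∈ Ioi (0 : ℝ), ‖D θ r‖ ≤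
      K * (j * (r ^ j * Real.exp (-(x / 2 * r))) + x * (r ^ (j + 1) * Real.exp (-(x / 2 * r))) +
        2 * |s| * (r ^ (j + 2) * Real.exp (-(x / 2 * r))) + r ^ j * Real.exp (-(x / 2 * r))) :=
    fun θ hθ r hr => by
      have hr' : (0 : ℝ) < r := hr
      set W := heatWave x s (r * e θ) with hW
      have e1 : D θ r = Complex.I * e θ * ((j * (r * e θ) ^ j * W +
          (r * e θ) ^ (j + 1) * (Complex.I * x) * W - (r * e θ) ^ (j + 2) * (2 * s) * W) +
          (r * e θ) ^ j * W) := by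
        rcases j with _ | j
        · simp only [hD, hf, hf', ← hW]; push_cast; ring
        · simp only [hD, hf, hf', ← hW]; rw [Nat.add_sub_cancel]; push_cast; ring
      rw [e1, norm_mul, norm_mul, Complex.norm_I, hen, one_mul, one_mul]
      have e2 : ∀ (c : ℂ) (m : ℕ), ‖(r * e θ) ^ m * c * W‖ ≤
          ‖c‖ * (r ^ m * (K * Real.exp (-(x / 2 * r)))) := fun c m => by
        rw [norm_mul, norm_mul, norm_pow, hnr θ r hr, mul_comm (r ^ m), mul_assoc]
        gcongr
        exact hwb θ hθ r hr
      have e3 := e2 j j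
      have e4 := e2 (Complex.I * x) (j + 1)
      have e5 := e2 (2 * s) (j + 2)
      have e6 := e2 1 j
      rw [mul_comm ((r * e θ) ^ j) (j : ℂ), Complex.norm_natCast] at e3
      rw [norm_mul Complex.I, Complex.norm_I, one_mul, Complex.norm_real,
        Real.norm_of_nonneg hx.le] at e4
      rw [norm_mul 2, Complex.norm_real, Complex.norm_ofNat, Real.norm_eq_abs] at e5
      rw [mul_one, norm_one] at e6
      refine (norm_add_le _ _).trans ?_
      have e7 := norm_sub_le (j * (r * e θ) ^ j * W + (r * e θ) ^ (j + 1) * (Complex.I * x) * W)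
        ((r * e θ) ^ (j + 2) * (2 * s) * W)
      have e8 := norm_add_le (j * (r * e θ) ^ j * W) ((r * e θ) ^ (j + 1) * (Complex.I * x) * W)
      linarith
  have hI := fun k => integrableOn_pow_mul_exp_neg k (half_pos hx)
  have hDI := (((((hI j).const_mul (j : ℝ)).add ((hI (j + 1)).const_mul x)).add
    ((hI (j + 2)).const_mul (2 * |s|))).add (hI j)).const_mul K
  set G : ℝ → ℂ := fun θ => ∫ r in Ioi (0 : ℝ), f (r * e θ) * e θ with hG
  have hGc : ContinuousOn G (Icc a b) := by
    refine continuousOn_of_dominated (bound := fun r => K * (r ^ j * Real.exp (-(x / 2 * r))))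
      (fun θ _ => Continuous.aestronglyMeasurable (by fun_prop)) (fun θ hθ => ?_)
      ((hI j).const_mul K) (Eventually.of_forall fun r => Continuous.continuousOn (by fun_prop))
    refine ae_restrict_of_forall_mem measurableSet_Ioi fun r hr => ?_
    rw [norm_mul, hen, mul_one]
    exact hfb θ hθ r hr
  have hGd : ∀ θ ∈ Ioo a b, HasDerivAt G 0 θ := fun θ hθ => by
    have h1 := (hasDerivAt_integral_of_dominated_loc_of_deriv_le (𝕜 := ℝ)
      (μ := volume.restrict (Ioi (0 : ℝ))) (F := fun θ r => f (r * e θ) * e θ)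
      (F' := fun θ r => D θ r) (x₀ := θ) (s := Ioo a b) (Ioo_mem_nhds hθ.1 hθ.2)
      (Eventually.of_forall fun θ => Continuous.aestronglyMeasurable (by fun_prop))
      (((hI j).const_mul K).mono' (Continuous.aestronglyMeasurable (by fun_prop))
        (ae_restrict_of_forall_mem measurableSet_Ioi fun r hr => by
          rw [norm_mul, hen, mul_one]
          exact hfb θ (Ioo_subset_Icc_self hθ) r hr))
      (hDc.comp (continuous_const.prodMk continuous_id)).aestronglyMeasurable
      (ae_restrict_of_forall_mem measurableSet_Ioi fun r hr θ hθ =>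
        hDb θ (Ioo_subset_Icc_self hθ) r hr) hDI
      (Eventually.of_forall fun r θ _ => hDθ θ r)).2
    have h2 : ∫ r in Ioi (0 : ℝ), D θ r = 0 := by
      have h3 : Tendsto (fun r : ℝ => f (r * e θ) * (r * (e θ * Complex.I))) atTop (𝓝 0) := by
        have h4 : Tendsto (fun r : ℝ => K * (r ^ (j + 1) * Real.exp (-(x / 2 * r)))) atTop
            (𝓝 0) := by
          have h5 := tendsto_rpow_mul_exp_neg_mul_atTop_nhds_zero ((j + 1 : ℕ) : ℝ) (x / 2)
            (half_pos hx)
          simp only [Real.rpow_natCast, neg_mul] at h5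
          simpa using h5.const_mul K
        refine squeeze_zero_norm' ?_ h4
        filter_upwards [Ioi_mem_atTop (0 : ℝ)] with r hr
        have hr' : (0 : ℝ) < r := hr
        rw [norm_mul, ← mul_assoc, norm_mul _ Complex.I, hnr θ r hr, Complex.norm_I, mul_one]
        calc ‖f (r * e θ)‖ * r ≤ K * (r ^ j * Real.exp (-(x / 2 * r))) * r := by
              gcongr; exact hfb θ (Ioo_subset_Icc_self hθ) r hr
          _ = _ := by ring
      have h6 := integral_Ioi_of_hasDerivAt_of_tendsto (a := 0)
        (hDr θ 0).continuousAt.continuousWithinAt (fun r _ => hDr θ r)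
        (hDI.mono' (hDc.comp (continuous_const.prodMk continuous_id)).aestronglyMeasurable
          (ae_restrict_of_forall_mem measurableSet_Ioi fun r hr =>
            hDb θ (Ioo_subset_Icc_self hθ) r hr)) h3
      rw [h6]
      simp
    rw [← h2]
    exact h1
  have hconst : ∀ c ∈ Ioo a b, G c = G b := fun c hc =>
    (constant_of_has_deriv_right_zero (hGc.mono (Icc_subset_Icc_left hc.1.le))
      (fun θ hθ => (hGd θ ⟨hc.1.trans_le hθ.1, hθ.2⟩).hasDerivWithinAt) b ⟨hc.2.le, le_rfl⟩).symm
  have hlim : Tendsto G (𝓝[>] a) (𝓝 (G a)) :=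
    ((hGc a ⟨le_rfl, hab.le⟩).mono Ioc_subset_Icc_self).tendsto.mono_left
      (nhdsWithin_Ioc_eq_nhdsGT hab).ge
  have hlim2 : Tendsto G (𝓝[>] a) (𝓝 (G b)) := by
    refine tendsto_const_nhds.congr' ?_
    filter_upwards [Ioo_mem_nhdsGT hab] with c hc
    exact (hconst c hc).symm
  exact tendsto_nhds_unique hlim hlim2

theorem integrable_pow_mul_heatWave (j : ℕ) (x : ℝ) {s : ℝ} (hs : 0 < s) :
    Integrable (fun lam : ℝ => (lam : ℂ) ^ j * heatWave x s lam) := by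
  have h := integrable_rpow_mul_exp_neg_mul_sq hs (s := j)
    (by have : (0 : ℝ) ≤ j := j.cast_nonneg
        linarith)
  have hc := continuous_heatWave x s
  refine h.norm.mono' (Continuous.aestronglyMeasurable (by fun_prop))
    (Eventually.of_forall fun r => ?_)
  rw [heatWave, norm_mul, norm_mul, Complex.norm_exp, Real.rpow_natCast, norm_pow, norm_pow,
    Complex.norm_real, Real.norm_of_nonneg (Real.exp_pos _).le]
  gcongr
  simp [pow_two]
  linarith

/-- For negative times one ray of `Γ` can be rotated into the other, through the imaginary axis. -/
theorem integralGamma_heatWave_of_neg (j : ℕ) {x s : ℝ} (hx : 0 < x) (hs : s < 0) :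
    integralGamma (fun lam => lam ^ j * heatWave x s lam) = 0 := by
  have hpi := Real.pi_pos
  rw [integralGamma_eq, sub_eq_zero]
  refine integralRay_heatWave_eq j hx hs.ne (by linarith) fun θ hθ => ⟨?_, ?_⟩
  · exact Real.sin_nonneg_of_nonneg_of_le_pi (by linarith [hθ.1]) (by linarith [hθ.2])
  · refine mul_nonneg_of_nonpos_of_nonpos hs.le ?_
    exact Real.cos_nonpos_of_pi_div_two_le_of_le (by linarith [hθ.1]) (by linarith [hθ.2])

/-- For positive times both rays of `Γ` can be rotated into the real line. -/
theorem integralGamma_heatWave_of_pos (j : ℕ) {x s : ℝ} (hx : 0 < x) (hs : 0 < s) :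
    integralGamma (fun lam => lam ^ j * heatWave x s lam) =
      ∫ lam : ℝ, (lam : ℂ) ^ j * heatWave x s lam := by
  have hpi := Real.pi_pos
  have hcos : ∀ θ, 0 ≤ θ → θ ≤ Real.pi / 4 → 0 ≤ s * Real.cos (2 * θ) := fun θ h1 h2 =>
    mul_nonneg hs.le (Real.cos_nonneg_of_neg_pi_div_two_le_of_le (by linarith) (by linarith))
  have hcos' : ∀ θ, 3 * Real.pi / 4 ≤ θ → θ ≤ Real.pi → 0 ≤ s * Real.cos (2 * θ) :=
    fun θ h1 h2 => by
      have := hcos (Real.pi - θ) (by linarith) (by linarith)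
      rwa [mul_sub, Real.cos_two_pi_sub] at this
  have h0 := integralRay_heatWave_eq j (a := 0) (b := Real.pi / 4) hx hs.ne' (by linarith)
    fun θ hθ => ⟨Real.sin_nonneg_of_nonneg_of_le_pi hθ.1 (by linarith [hθ.2]),
      hcos θ hθ.1 hθ.2⟩
  have h1 := integralRay_heatWave_eq j (a := 3 * Real.pi / 4) (b := Real.pi) hx hs.ne'
    (by linarith) fun θ hθ => ⟨Real.sin_nonneg_of_nonneg_of_le_pi (by linarith [hθ.1]) hθ.2,
      hcos' θ hθ.1 hθ.2⟩
  have hi := integrable_pow_mul_heatWave j x hs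
  rw [integralGamma_eq, ← h0, h1, integralRay, integralRay]
  simp only [Complex.exp_pi_mul_I, Complex.ofReal_zero, zero_mul, Complex.exp_zero, mul_one,
    mul_neg, integral_neg, sub_neg_eq_add]
  have h2 := integral_comp_neg_Ioi (0 : ℝ) (fun r : ℝ => (r : ℂ) ^ j * heatWave x s r)
  simp only [Complex.ofReal_neg, neg_zero] at h2
  rw [h2, add_comm]
  exact intervalIntegral.integral_Iic_add_Ioi hi.integrableOn hi.integrableOn

/-! ### Gaussian integrals and the Poisson kernel -/

theorem ofReal_pi_eq_sqrt_mul_sqrt : (Real.pi : ℂ) = Real.sqrt Real.pi * Real.sqrt Real.pi := by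
  rw [← Complex.ofReal_mul, Real.mul_self_sqrt Real.pi_pos.le]

theorem ofReal_sqrt_pi_ne_zero : (Real.sqrt Real.pi : ℂ) ≠ 0 := by
  exact_mod_cast (Real.sqrt_pos.2 Real.pi_pos).ne'

theorem integral_heatWave (x : ℝ) {s : ℝ} (hs : 0 < s) :
    ∫ lam : ℝ, heatWave x s lam = (Real.sqrt Real.pi * heatPow (1 / 2) (x, s) : ℝ) := by
  have h := fourierIntegral_gaussian (b := s) (by simpa using hs) x
  have h1 : ∀ lam : ℝ, heatWave x s lam =
      Complex.exp (Complex.I * x * lam) * Complex.exp (-s * (lam : ℂ) ^ 2) := fun lam => by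
    rw [heatWave, ← Complex.exp_add]
    congr 1
    ring
  simp only [h1]
  rw [h, heatPow, if_pos hs]
  have h2 : ((Real.pi : ℂ) / s) ^ (1 / 2 : ℂ) = ((Real.sqrt Real.pi * s ^ (-(1 / 2 : ℝ)) : ℝ) : ℂ) := by
    rw [← Complex.ofReal_div, show (1 / 2 : ℂ) = ((1 / 2 : ℝ) : ℂ) by push_cast; rfl,
      ← Complex.ofReal_cpow (by positivity), Real.div_rpow Real.pi_pos.le hs.le,
      Real.sqrt_eq_rpow, Real.rpow_neg hs.le, div_eq_mul_inv]
  rw [h2, ← mul_assoc]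
  push_cast
  congr 2
  ring

/-- The first moment follows from the integral itself, as
`∂/∂λ e^{iλx - λ²s} = (ix - 2λs) e^{iλx - λ²s}` has integral zero. -/
theorem integral_mul_heatWave (x : ℝ) {s : ℝ} (hs : 0 < s) :
    ∫ lam : ℝ, (lam : ℂ) * heatWave x s lam =
      Complex.I * (x * Real.sqrt Real.pi / 2 * heatPow (3 / 2) (x, s) : ℝ) := by
  have i0 := (integrable_pow_mul_heatWave 0 x hs)
  have i1 := (integrable_pow_mul_heatWave 1 x hs)
  simp only [pow_zero, one_mul, pow_one] at i0 i1
  have h := integral_eq_zero_of_hasDerivAt_of_integrable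
    (f := fun lam : ℝ => heatWave x s lam)
    (f' := fun lam : ℝ => Complex.I * x * heatWave x s lam - 2 * s * (lam * heatWave x s lam))
    (fun lam => by
      convert! (hasDerivAt_heatWave x s lam).comp_ofReal using 1
      ring)
    ((i0.const_mul _).sub (i1.const_mul _)) i0
  rw [integral_sub (i0.const_mul _) (i1.const_mul _), integral_const_mul, integral_const_mul,
    integral_heatWave x hs, sub_eq_zero] at h
  have hs' : (s : ℂ) ≠ 0 := by exact_mod_cast hs.ne'
  have h1 : heatPow (1 / 2) (x, s) = s * heatPow (3 / 2) (x, s) := by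
    rw [heatPow, heatPow, if_pos hs, if_pos hs, ← mul_assoc]
    congr 1
    rw [show (-(1 / 2) : ℝ) = 1 + -(3 / 2) by norm_num, Real.rpow_add hs, Real.rpow_one]
  rw [h1] at h
  refine mul_left_cancel₀ (mul_ne_zero two_ne_zero hs') (h.symm.trans ?_)
  push_cast
  ring

/-- The Poisson kernel of the half line for the heat equation, as the contour integral that the
unified transform method produces. -/
theorem integralGamma_mul_heatWave {x s : ℝ} (hx : 0 < x) (hs : s ≠ 0) :
    integralGamma (fun lam => lam * heatWave x s lam) =
      Complex.I * (x * Real.sqrt Real.pi / 2 * heatPow (3 / 2) (x, s) : ℝ) := by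
  rcases hs.lt_or_gt with hs | hs
  · have h := integralGamma_heatWave_of_neg 1 hx hs
    simp only [pow_one] at h
    rw [h, heatPow, if_neg (not_lt.2 hs.le)]
    simp
  · have h := integralGamma_heatWave_of_pos 1 hx hs
    simp only [pow_one] at h
    rw [h, integral_mul_heatWave x hs]

/-! ### Rapidly decaying amplitudes and the Fourier transform -/

/-- Continuous functions on the line that decay faster than any power. -/
def RapidlyDecaying (ψ : ℝ → ℂ) : Prop :=
  Continuous ψ ∧ ∀ k : ℕ, ∃ C : ℝ, ∀ r : ℝ, |r| ^ k * ‖ψ r‖ ≤ C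

theorem RapidlyDecaying.integrable {ψ : ℝ → ℂ} (hψ : RapidlyDecaying ψ) (k : ℕ) :
    Integrable (fun r => ‖ψ r‖ * |r| ^ k) := by
  obtain ⟨A, hA⟩ := hψ.2 k
  obtain ⟨B, hB⟩ := hψ.2 (k + 2)
  have hc := hψ.1
  refine (integrable_inv_one_add_sq.const_mul (A + B)).mono'
    (Continuous.aestronglyMeasurable (by fun_prop)) (Eventually.of_forall fun r => ?_)
  rw [Real.norm_of_nonneg (by positivity), ← div_eq_mul_inv, le_div_iff₀ (by positivity)]
  calc ‖ψ r‖ * |r| ^ k * (1 + r ^ 2) = |r| ^ k * ‖ψ r‖ + |r| ^ (k + 2) * ‖ψ r‖ := by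
        rw [← sq_abs r]; ring
    _ ≤ A + B := add_le_add (hA r) (hB r)

theorem RapidlyDecaying.contDiff_integral {ψ : ℝ → ℂ} (hψ : RapidlyDecaying ψ) (S : Set ℝ)
    (L₁ L₂ : ℝ × ℝ →L[ℝ] ℝ × ℝ) :
    ContDiff ℝ ∞ (fun p => ∫ r in S, ψ r * cutWave ((r • L₁ + r ^ 2 • L₂) p)) := by
  have hM : Continuous fun r : ℝ => r • L₁ + r ^ 2 • L₂ := by fun_prop
  refine contDiff_integral_cutWave hM.aestronglyMeasurable hψ.1.aestronglyMeasurable fun k => ?_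
  refine Integrable.integrableOn ?_
  refine (((hψ.integrable k).add (hψ.integrable (2 * k))).const_mul
    ((‖L₁‖ + ‖L₂‖) ^ k)).mono'
    ((hψ.1.norm.mul (hM.norm.pow k)).aestronglyMeasurable) (Eventually.of_forall fun r => ?_)
  rw [Real.norm_of_nonneg (by positivity)]
  -- `‖M r‖ ≤ (‖L₁‖ + ‖L₂‖) max(|r|, r²)`
  have h1 : ‖r • L₁ + r ^ 2 • L₂‖ ≤ (‖L₁‖ + ‖L₂‖) * max |r| (|r| ^ 2) := by
    refine (norm_add_le _ _).trans ?_
    rw [norm_smul, norm_smul, norm_pow, Real.norm_eq_abs, add_mul, mul_comm, mul_comm (|r| ^ 2)]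
    gcongr
    · exact le_max_left _ _
    · exact le_max_right _ _
  have h2 : max |r| (|r| ^ 2) ^ k ≤ |r| ^ k + |r| ^ (2 * k) := by
    rw [pow_mul]
    rcases max_choice |r| (|r| ^ 2) with h | h <;> rw [h]
    · exact le_add_of_nonneg_right (by positivity)
    · exact le_add_of_nonneg_left (by positivity)
  calc ‖ψ r‖ * ‖r • L₁ + r ^ 2 • L₂‖ ^ k
      ≤ ‖ψ r‖ * ((‖L₁‖ + ‖L₂‖) * max |r| (|r| ^ 2)) ^ k := by gcongr
    _ ≤ ‖ψ r‖ * ((‖L₁‖ + ‖L₂‖) ^ k * (|r| ^ k + |r| ^ (2 * k))) := by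
        rw [mul_pow]; gcongr
    _ = _ := by simp only [Pi.add_apply]; ring

/-- The Fourier transform `∫ F(y) e^{-iωy} dy` on the line. -/
noncomputable def lineFourier (F : ℝ → ℂ) (w : ℝ) : ℂ :=
  ∫ y : ℝ, F y * Complex.exp (-Complex.I * w * y)

theorem norm_exp_neg_I_mul_ofReal_mul (w y : ℝ) : ‖Complex.exp (-Complex.I * w * y)‖ = 1 := by
  rw [Complex.norm_exp]
  simp

theorem continuous_lineFourier {F : ℝ → ℂ} (hF : Integrable F) : Continuous (lineFourier F) := by
  refine continuous_of_dominated (bound := fun y => ‖F y‖) (fun w => ?_) (fun w => ?_) hF.norm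
    (Eventually.of_forall fun y => by fun_prop)
  · exact hF.aestronglyMeasurable.mul (Continuous.aestronglyMeasurable (by fun_prop))
  · exact Eventually.of_forall fun y => by rw [norm_mul, norm_exp_neg_I_mul_ofReal_mul, mul_one]

theorem norm_lineFourier_le (F : ℝ → ℂ) (w : ℝ) : ‖lineFourier F w‖ ≤ ∫ y, ‖F y‖ := by
  refine (norm_integral_le_integral_norm _).trans_eq ?_
  simp only [norm_mul, norm_exp_neg_I_mul_ofReal_mul, mul_one]

theorem lineFourier_add {F G : ℝ → ℂ} (hF : Integrable F) (hG : Integrable G) (w : ℝ) :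
    lineFourier (F + G) w = lineFourier F w + lineFourier G w := by
  have h : ∀ {F : ℝ → ℂ}, Integrable F →
      Integrable fun y : ℝ => F y * Complex.exp (-Complex.I * w * y) := fun hF =>
    hF.mul_bdd (c := 1) (Continuous.aestronglyMeasurable (by fun_prop))
      (Eventually.of_forall fun y => (norm_exp_neg_I_mul_ofReal_mul w y).le)
  rw [lineFourier, lineFourier, lineFourier, ← integral_add (h hF) (h hG)]
  simp only [Pi.add_apply, add_mul]

theorem rapidlyDecaying_lineFourier (φ : SchwartzMap ℝ ℂ) : RapidlyDecaying (lineFourier φ) := by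
  refine ⟨continuous_lineFourier φ.integrable, fun k => ?_⟩
  obtain ⟨C, hC⟩ := (FourierTransform.fourier φ).decay k 0
  refine ⟨(2 * Real.pi) ^ k * C, fun w => ?_⟩
  have hpi := Real.pi_pos
  have h1 : FourierTransform.fourier φ (w / (2 * Real.pi)) = lineFourier φ w := by
    rw [SchwartzMap.fourier_coe, Real.fourier_real_eq_integral_exp_smul, lineFourier]
    refine integral_congr_ae (Eventually.of_forall fun y => ?_)
    simp only [smul_eq_mul]
    rw [mul_comm]
    congr 2
    push_cast
    field_simp
  have h2 := hC.2 (w / (2 * Real.pi))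
  rw [norm_iteratedFDeriv_zero, h1, Real.norm_eq_abs, abs_div, abs_of_pos (a := 2 * Real.pi)
    (by positivity), div_pow, div_mul_eq_mul_div, div_le_iff₀ (by positivity)] at h2
  linarith

/-! ### The heat flow on the line -/

theorem integral_mul_integral_swap {μ ν : Measure ℝ} [SFinite μ] [SFinite ν] {g F : ℝ → ℂ}
    (hg : Integrable g μ) (hF : Integrable F ν) {k : ℝ → ℝ → ℂ}
    (hk : Continuous (Function.uncurry k)) (hb : ∀ᵐ q ∂(μ.prod ν), ‖k q.1 q.2‖ ≤ 1) :
    ∫ r, g r * ∫ y, F y * k r y ∂ν ∂μ = ∫ y, F y * ∫ r, g r * k r y ∂μ ∂ν := by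
  have h1 : Integrable (Function.uncurry fun r y => g r * F y * k r y) (μ.prod ν) :=
    (hg.mul_prod hF).mul_bdd (c := 1) hk.aestronglyMeasurable hb
  have h2 := integral_integral_swap h1
  have h3 : ∀ r y, g r * (F y * k r y) = g r * F y * k r y := fun r y => (mul_assoc _ _ _).symm
  have h4 : ∀ r y, F y * (g r * k r y) = g r * F y * k r y := fun r y => by ring
  simp only [← integral_const_mul, h3, h4]
  exact h2

/-- The solution of the heat equation on the line with initial datum `F`, as a Fourier integral. -/
noncomputable def lineHeat (F : ℝ → ℂ) (p : ℝ × ℝ) : ℂ :=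
  1 / (2 * Real.pi) * ∫ lam : ℝ, heatWave p.1 p.2 lam * lineFourier F lam

theorem heatWave_ofReal_eq_cutWave (x : ℝ) {t : ℝ} (ht : 0 ≤ t) (r : ℝ) :
    heatWave x t r = cutWave (r * x, r ^ 2 * t) := by
  rw [cutWave, cutExp_of_nonneg (by positivity), heatWave, ← Complex.exp_add]
  congr 1
  push_cast
  ring

theorem heatWave_add_time (x t s : ℝ) (lam : ℂ) :
    heatWave x (t + s) lam = heatWave x t lam * heatWave 0 s lam := by
  rw [heatWave, heatWave, heatWave, ← Complex.exp_add]
  congr 1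
  push_cast
  ring

theorem norm_heatWave_ofReal (x t r : ℝ) : ‖heatWave x t r‖ = Real.exp (-(r ^ 2 * t)) := by
  rw [heatWave, Complex.norm_exp]
  congr 1
  simp [pow_two]

/-- With a rapidly decaying amplitude, a superposition of heat waves is smooth up to `t = 0`, in the
strong sense that it extends smoothly to all `t ∈ ℝ`. -/
theorem exists_contDiff_integral_heatWave {ψ : ℝ → ℂ} (hψ : RapidlyDecaying ψ) :
    ∃ G : ℝ × ℝ → ℂ, ContDiff ℝ ∞ G ∧ ∀ p : ℝ × ℝ, 0 ≤ p.2 →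
      G p = ∫ lam : ℝ, heatWave p.1 p.2 lam * ψ lam := by
  refine ⟨_, hψ.contDiff_integral univ
    ((ContinuousLinearMap.fst ℝ ℝ ℝ).prod 0) ((0 : ℝ × ℝ →L[ℝ] ℝ).prod
      (ContinuousLinearMap.snd ℝ ℝ ℝ)), fun p hp => ?_⟩
  rw [setIntegral_univ]
  refine integral_congr_ae (Eventually.of_forall fun r => ?_)
  simp only
  rw [heatWave_ofReal_eq_cutWave _ hp, mul_comm]
  simp

theorem exists_contDiff_lineHeat_schwartz (φ : SchwartzMap ℝ ℂ) :
    ∃ G : ℝ × ℝ → ℂ, ContDiff ℝ ∞ G ∧ ∀ p : ℝ × ℝ, 0 ≤ p.2 → G p = lineHeat φ p := by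
  obtain ⟨G, hG, h⟩ := exists_contDiff_integral_heatWave (rapidlyDecaying_lineFourier φ)
  exact ⟨_, contDiff_const.mul hG, fun p hp => by rw [h p hp, lineHeat]⟩

theorem rapidlyDecaying_heatWave_mul {ψ : ℝ → ℂ} (hψ : Continuous ψ) {C : ℝ}
    (hC : ∀ r, ‖ψ r‖ ≤ C) {c : ℝ} (hc : 0 < c) :
    RapidlyDecaying (fun r => heatWave 0 c r * ψ r) := by
  refine ⟨((continuous_heatWave 0 c).comp Complex.continuous_ofReal).mul hψ, fun k => ?_⟩
  refine ⟨(1 + k.factorial / c ^ k) * C, fun r => ?_⟩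
  have hC0 : 0 ≤ C := (norm_nonneg _).trans (hC 0)
  rw [norm_mul, norm_heatWave_ofReal, ← mul_assoc]
  refine mul_le_mul ?_ (hC r) (norm_nonneg _) (by positivity)
  rw [Real.exp_neg, ← div_eq_mul_inv, div_le_iff₀ (Real.exp_pos _)]
  have h1 : |r| ^ k ≤ 1 + (r ^ 2) ^ k := by
    rw [← sq_abs, ← pow_mul, mul_comm, pow_mul, ← one_mul (|r| ^ k)]
    nlinarith [sq_nonneg (|r| ^ k - 1)]
  have h2 := Real.pow_div_factorial_le_exp (r ^ 2 * c) (by positivity) k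
  rw [div_le_iff₀ (by positivity), mul_pow] at h2
  have h3 : (r ^ 2) ^ k ≤ k.factorial / c ^ k * Real.exp (r ^ 2 * c) := by
    rw [div_mul_eq_mul_div, le_div_iff₀ (by positivity)]
    linarith
  have h4 : 1 ≤ Real.exp (r ^ 2 * c) := Real.one_le_exp (by positivity)
  linarith

/-- For `t > 0` the Gaussian factor makes the amplitude decay: half of the available time is given to
the amplitude, the other half to the heat wave. -/
theorem contDiffAt_lineHeat {F : ℝ → ℂ} (hF : Integrable F) {p : ℝ × ℝ} (hp : 0 < p.2) :
    ContDiffAt ℝ ∞ (lineHeat F) p := by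
  obtain ⟨G, hG, h⟩ := exists_contDiff_integral_heatWave (rapidlyDecaying_heatWave_mul
    (continuous_lineFourier hF) (norm_lineFourier_le F) (half_pos hp))
  have h1 : ContDiff ℝ ∞ (fun q : ℝ × ℝ => 1 / (2 * Real.pi : ℂ) * G (q.1, q.2 - p.2 / 2)) :=
    contDiff_const.mul (hG.comp (contDiff_fst.prodMk (contDiff_snd.sub contDiff_const)))
  refine h1.contDiffAt.congr_of_eventuallyEq ?_
  have ho : IsOpen {q : ℝ × ℝ | p.2 / 2 < q.2} := isOpen_lt continuous_const continuous_snd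
  filter_upwards [ho.mem_nhds (half_lt_self hp)] with q hq
  have hq : p.2 / 2 < q.2 := hq
  rw [h _ (by simp only; linarith), lineHeat]
  congr 1
  refine integral_congr_ae (Eventually.of_forall fun r => ?_)
  simp only
  rw [← mul_assoc, ← heatWave_add_time, sub_add_cancel]

theorem lineHeat_eq_integral_heatPow {F : ℝ → ℂ} (hF : Integrable F) {p : ℝ × ℝ} (hp : 0 < p.2) :
    lineHeat F p = ((2 * Real.sqrt Real.pi : ℝ) : ℂ)⁻¹ *
      ∫ y, F y * (heatPow (1 / 2) (p.1 - y, p.2) : ℂ) := by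
  have hg : Integrable fun r : ℝ => heatWave p.1 p.2 r := by
    simpa using integrable_pow_mul_heatWave 0 p.1 hp
  have h := integral_mul_integral_swap hg hF
    (k := fun r y => Complex.exp (-Complex.I * r * y)) (by unfold Function.uncurry; fun_prop)
    (Eventually.of_forall fun q => (norm_exp_neg_I_mul_ofReal_mul q.1 q.2).le)
  have h1 : ∀ y r : ℝ, heatWave p.1 p.2 r * Complex.exp (-Complex.I * r * y) =
      heatWave (p.1 - y) p.2 r := fun y r => by
    rw [heatWave, heatWave, ← Complex.exp_add]
    congr 1
    push_cast
    ring
  simp only [h1, integral_heatWave _ hp] at h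
  simp only [lineHeat, lineFourier]
  rw [h]
  have h2 : ∀ y, F y * ((Real.sqrt Real.pi * heatPow (1 / 2) (p.1 - y, p.2) : ℝ) : ℂ) =
      Real.sqrt Real.pi * (F y * (heatPow (1 / 2) (p.1 - y, p.2) : ℂ)) := fun y => by
    push_cast; ring
  simp only [h2, integral_const_mul]
  rw [← mul_assoc]
  congr 1
  have h4 := ofReal_sqrt_pi_ne_zero
  rw [ofReal_pi_eq_sqrt_mul_sqrt]
  push_cast
  field_simp

/-- Smoothness of `∫ F(y) heatPow a (L(p, y)) dy` at points `p` for which `L(p, ·)` avoids the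
singularity of the kernel on the support of `F`. -/
theorem contDiffAt_integral_heatPow {F : ℝ → ℂ} (hF : Integrable F) {k : Set ℝ} (hk : IsCompact k)
    (hFk : ∀ y ∉ k, F y = 0) {L : ℝ × ℝ → ℝ → ℝ × ℝ}
    (hL : ContDiff ℝ ∞ (Function.uncurry L)) (a : ℝ) {p : ℝ × ℝ} (hp : ∀ y ∈ k, L p y ≠ 0) :
    ContDiffAt ℝ ∞ (fun q => ∫ y, F y * (heatPow a (L q y) : ℂ)) p := by
  have hW : IsOpen {z : (ℝ × ℝ) × ℝ | L z.1 z.2 ≠ 0} := isOpen_ne_fun hL.continuous continuous_const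
  refine contDiffAt_integral_mul_of_compact (F := fun z => (heatPow a (L z.1 z.2) : ℂ))
    hW (fun z hz => ?_) hF hk hFk hp
  have h1 : ContDiffAt ℝ ∞ (heatPow a) (Function.uncurry L z) := contDiffAt_heatPow a hz
  exact (Complex.ofRealCLM.contDiff.contDiffAt.comp z
    (h1.comp z hL.contDiffAt)).contDiffWithinAt

/-! ### Initial data on the half line -/

theorem IsSmoothHalfLine.contDiffAt {f : ℝ → ℂ} (hf : IsSmoothHalfLine f) {x : ℝ} (hx : 0 < x) :
    ContDiffAt ℝ ∞ f x :=
  hf.1.contDiffAt (isOpen_Ioi.mem_nhds hx)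

theorem IsSmoothHalfLine.continuousOn {f : ℝ → ℂ} (hf : IsSmoothHalfLine f) :
    ContinuousOn f (Ioi 0) := hf.1.continuousOn

theorem IsSchwartzHalfLine.integrable_indicator {u : ℝ → ℂ} (hu : IsSchwartzHalfLine u) :
    Integrable ((Ioi 0).indicator u) := by
  rw [integrable_indicator_iff measurableSet_Ioi]
  obtain ⟨A, hA⟩ := hu.2 0 0
  obtain ⟨B, hB⟩ := hu.2 2 0
  refine (integrable_inv_one_add_sq.const_mul (A + B)).integrableOn.mono'
    (hu.1.continuousOn.aestronglyMeasurable measurableSet_Ioi)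
    (ae_restrict_of_forall_mem measurableSet_Ioi fun x hx => ?_)
  have h1 := hA x hx
  have h2 := hB x hx
  rw [norm_mul, norm_pow, Complex.norm_real, Real.norm_eq_abs, iteratedDeriv_zero] at h1 h2
  rw [← div_eq_mul_inv, le_div_iff₀ (by positivity), ← sq_abs]
  linarith

/-- A cutoff rising smoothly from `0` on `(-∞, a]` to `1` on `[2a, ∞)`. -/
noncomputable def riseCutoff (a y : ℝ) : ℝ := Real.smoothTransition ((y - a) / a)

theorem riseCutoff_of_le {a y : ℝ} (ha : 0 < a) (hy : y ≤ a) : riseCutoff a y = 0 :=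
  Real.smoothTransition.zero_of_nonpos (div_nonpos_of_nonpos_of_nonneg (by linarith) ha.le)

theorem riseCutoff_of_ge {a y : ℝ} (ha : 0 < a) (hy : 2 * a ≤ y) : riseCutoff a y = 1 :=
  Real.smoothTransition.one_of_one_le (by rw [le_div_iff₀ ha]; linarith)

theorem contDiff_riseCutoff (a : ℝ) : ContDiff ℝ ∞ (riseCutoff a) :=
  Real.smoothTransition.contDiff.comp ((contDiff_id.sub contDiff_const).div_const a)

theorem contDiff_riseCutoff_mul {a : ℝ} (ha : 0 < a) {u : ℝ → ℂ} (hu : IsSmoothHalfLine u) :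
    ContDiff ℝ ∞ (fun y => (riseCutoff a y : ℂ) * u y) := by
  rw [contDiff_iff_contDiffAt]
  intro y
  rcases lt_or_ge y a with hy | hy
  · refine (contDiffAt_const (c := (0 : ℂ))).congr_of_eventuallyEq ?_
    filter_upwards [gt_mem_nhds hy] with z hz
    rw [riseCutoff_of_le ha (le_of_lt hz), Complex.ofReal_zero, zero_mul]
  · exact (Complex.ofRealCLM.contDiff.comp (contDiff_riseCutoff a)).contDiffAt.mul
      (hu.contDiffAt (ha.trans_le hy))

/-- A Schwartz function on the half line, cut off near the origin, as a Schwartz function on the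
line. -/
noncomputable def IsSchwartzHalfLine.cutoff {u : ℝ → ℂ} (hu : IsSchwartzHalfLine u) {a : ℝ}
    (ha : 0 < a) : SchwartzMap ℝ ℂ where
  toFun y := (riseCutoff a y : ℂ) * u y
  smooth' := contDiff_riseCutoff_mul ha hu.1
  decay' := by
    intro m n
    have hs := contDiff_riseCutoff_mul ha hu.1
    have hc : Continuous fun y =>
        ‖y‖ ^ m * ‖iteratedFDeriv ℝ n (fun y => (riseCutoff a y : ℂ) * u y) y‖ :=
      (continuous_norm.pow m).mul (hs.continuous_iteratedFDeriv (by exact_mod_cast le_top)).norm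
    obtain ⟨A, hA⟩ := (isCompact_Icc (a := a) (b := 2 * a)).bddAbove_image hc.continuousOn
    obtain ⟨B, hB⟩ := hu.2 m n
    refine ⟨max (max A B) 0, fun y => ?_⟩
    by_cases h1 : y < a
    · have : (fun y => (riseCutoff a y : ℂ) * u y) =ᶠ[𝓝 y] fun _ => 0 := by
        filter_upwards [gt_mem_nhds h1] with z hz
        rw [riseCutoff_of_le ha (le_of_lt hz), Complex.ofReal_zero, zero_mul]
      rw [this.iteratedFDeriv ℝ n |>.eq_of_nhds, norm_iteratedFDeriv_eq_norm_iteratedDeriv,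
        iteratedDeriv_const]
      simp
    by_cases h2 : 2 * a < y
    · have : (fun y => (riseCutoff a y : ℂ) * u y) =ᶠ[𝓝 y] u := by
        filter_upwards [lt_mem_nhds h2] with z hz
        rw [riseCutoff_of_ge ha (le_of_lt hz), Complex.ofReal_one, one_mul]
      rw [this.iteratedFDeriv ℝ n |>.eq_of_nhds, norm_iteratedFDeriv_eq_norm_iteratedDeriv]
      have h3 := hB y (by linarith)
      rw [norm_mul, norm_pow, Complex.norm_real] at h3
      exact h3.trans ((le_max_right _ _).trans (le_max_left _ _))
    · exact (hA ⟨y, ⟨not_lt.1 h1, not_lt.1 h2⟩, rfl⟩).trans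
        ((le_max_left _ _).trans (le_max_left _ _))

/-! ### Local smooth extensions -/

/-- `v` agrees on `s` near `p` with a function that is smooth at `p`. -/
def SmoothlyExtendsAt (s : Set (ℝ × ℝ)) (v : ℝ × ℝ → ℂ) (p : ℝ × ℝ) : Prop :=
  ∃ G : ℝ × ℝ → ℂ, ContDiffAt ℝ ∞ G p ∧ ∀ᶠ q in 𝓝 p, q ∈ s → v q = G q

theorem ContDiffAt.smoothlyExtendsAt {s : Set (ℝ × ℝ)} {v : ℝ × ℝ → ℂ} {p : ℝ × ℝ}
    (h : ContDiffAt ℝ ∞ v p) : SmoothlyExtendsAt s v p :=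
  ⟨v, h, Eventually.of_forall fun _ _ => rfl⟩

namespace SmoothlyExtendsAt

variable {s s' : Set (ℝ × ℝ)} {v w : ℝ × ℝ → ℂ} {p : ℝ × ℝ}

theorem add (hv : SmoothlyExtendsAt s v p) (hw : SmoothlyExtendsAt s w p) :
    SmoothlyExtendsAt s (v + w) p := by
  obtain ⟨G, hG, h1⟩ := hv
  obtain ⟨H, hH, h2⟩ := hw
  refine ⟨G + H, hG.add hH, ?_⟩
  filter_upwards [h1, h2] with q h3 h4 hq
  rw [Pi.add_apply, Pi.add_apply, h3 hq, h4 hq]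

theorem sub (hv : SmoothlyExtendsAt s v p) (hw : SmoothlyExtendsAt s w p) :
    SmoothlyExtendsAt s (v - w) p := by
  obtain ⟨G, hG, h1⟩ := hv
  obtain ⟨H, hH, h2⟩ := hw
  refine ⟨G - H, hG.sub hH, ?_⟩
  filter_upwards [h1, h2] with q h3 h4 hq
  rw [Pi.sub_apply, Pi.sub_apply, h3 hq, h4 hq]

theorem congr (hv : SmoothlyExtendsAt s v p) (h : ∀ᶠ q in 𝓝 p, q ∈ s → w q = v q) :
    SmoothlyExtendsAt s w p := by
  obtain ⟨G, hG, h1⟩ := hv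
  refine ⟨G, hG, ?_⟩
  filter_upwards [h, h1] with q h2 h3 hq
  rw [h2 hq, h3 hq]

theorem comp {f : ℝ × ℝ → ℝ × ℝ} (hv : SmoothlyExtendsAt s v (f p)) (hf : ContDiff ℝ ∞ f)
    (hfs : MapsTo f s' s) : SmoothlyExtendsAt s' (v ∘ f) p := by
  obtain ⟨G, hG, h1⟩ := hv
  refine ⟨G ∘ f, hG.comp p hf.contDiffAt, ?_⟩
  filter_upwards [hf.continuous.continuousAt.eventually h1] with q h2 hq
  exact h2 (hfs hq)

end SmoothlyExtendsAt

theorem lineHeat_add {F G : ℝ → ℂ} (hF : Integrable F) (hG : Integrable G) {p : ℝ × ℝ}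
    (hp : 0 < p.2) : lineHeat (F + G) p = lineHeat F p + lineHeat G p := by
  have h : ∀ {F : ℝ → ℂ}, Integrable F →
      Integrable fun r : ℝ => heatWave p.1 p.2 r * lineFourier F r := fun {F} hF => by
    have hg : Integrable fun r : ℝ => heatWave p.1 p.2 r := by
      simpa using integrable_pow_mul_heatWave 0 p.1 hp
    exact hg.mul_bdd (continuous_lineFourier hF).aestronglyMeasurable
      (Eventually.of_forall (norm_lineFourier_le F))
  rw [lineHeat, lineHeat, lineHeat, ← mul_add, ← integral_add (h hF) (h hG)]
  simp only [lineFourier_add hF hG, mul_add]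

/-- The heat flow of a Schwartz function on the half line, extended by zero, is smooth up to `t = 0`
away from `x = 0`: the datum is the sum of a Schwartz function on the line, whose Fourier transform
decays rapidly, and of a function supported at a positive distance from `x`, on which the heat kernel
is smooth up to `t = 0`. -/
theorem smoothlyExtendsAt_lineHeat {u : ℝ → ℂ} (hu : IsSchwartzHalfLine u) {p : ℝ × ℝ}
    (hp : 0 ≤ p.2) (hp0 : p ≠ 0) :
    SmoothlyExtendsAt {q | 0 < q.2} (lineHeat ((Ioi 0).indicator u)) p := by
  rcases hp.lt_or_eq with hp | hp
  · exact (contDiffAt_lineHeat hu.integrable_indicator hp).smoothlyExtendsAt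
  have hx : p.1 ≠ 0 := fun h => hp0 (Prod.ext h hp.symm)
  set a : ℝ := |p.1| / 4 with ha'
  have ha : 0 < a := by positivity
  set φ := hu.cutoff ha with hφ
  set f : ℝ → ℂ := (Ioi 0).indicator u - φ with hf
  have hfi : Integrable f := hu.integrable_indicator.sub φ.integrable
  have hφa : ∀ y, φ y = (riseCutoff a y : ℂ) * u y := fun y => rfl
  have hf0 : ∀ y ∉ Icc 0 (2 * a), f y = 0 := fun y hy => by
    rw [hf, Pi.sub_apply, hφa]
    rcases lt_or_ge y 0 with h | h
    · rw [riseCutoff_of_le ha (by linarith), indicator_of_notMem (by simp [h.le])]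
      simp
    · have h2 : 2 * a < y := by
        by_contra h3
        exact hy ⟨h, not_lt.1 h3⟩
      rw [riseCutoff_of_ge ha h2.le, indicator_of_mem (by simp only [mem_Ioi]; linarith)]
      simp
  have hsum : (Ioi 0).indicator u = φ + f := by rw [hf]; abel
  obtain ⟨G, hG, hGe⟩ := exists_contDiff_lineHeat_schwartz φ
  have h1 : SmoothlyExtendsAt {q | 0 < q.2} (lineHeat φ) p :=
    ⟨G, hG.contDiffAt, Eventually.of_forall fun q hq => (hGe q (le_of_lt hq)).symm⟩
  have h2 : ContDiffAt ℝ ∞ (fun q : ℝ × ℝ => ((2 * Real.sqrt Real.pi : ℝ) : ℂ)⁻¹ *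
      ∫ y, f y * (heatPow (1 / 2) (q.1 - y, q.2) : ℂ)) p := by
    refine contDiffAt_const.mul (contDiffAt_integral_heatPow hfi (isCompact_Icc (a := 0)
      (b := 2 * a)) hf0 (L := fun q y => (q.1 - y, q.2)) ?_ _ fun y hy h => ?_)
    · unfold Function.uncurry; fun_prop
    · have h3 : p.1 - y = 0 := congrArg Prod.fst h
      have h4 : p.1 = y := by linarith
      have h5 : |p.1| = y := by rw [h4, abs_of_nonneg hy.1]
      have := hy.2
      linarith
  have h3 : SmoothlyExtendsAt {q | 0 < q.2} (lineHeat f) p :=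
    ⟨_, h2, Eventually.of_forall fun q hq => lineHeat_eq_integral_heatPow hfi hq⟩
  refine (h1.add h3).congr (Eventually.of_forall fun q hq => ?_)
  rw [hsum, lineHeat_add φ.integrable hfi hq, Pi.add_apply]

/-! ### The contour integral of the initial datum -/

theorem integrable_mul_integral {μ ν : Measure ℝ} [SFinite μ] [SFinite ν] {g F : ℝ → ℂ}
    (hg : Integrable g μ) (hF : Integrable F ν) {k : ℝ → ℝ → ℂ}
    (hk : Continuous (Function.uncurry k)) (hb : ∀ᵐ q ∂(μ.prod ν), ‖k q.1 q.2‖ ≤ 1) :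
    Integrable (fun y => F y * ∫ r, g r * k r y ∂μ) ν := by
  have h1 : Integrable (Function.uncurry fun r y => g r * F y * k r y) (μ.prod ν) :=
    (hg.mul_prod hF).mul_bdd (c := 1) hk.aestronglyMeasurable hb
  refine h1.integral_prod_right.congr (Eventually.of_forall fun y => ?_)
  simp only [← integral_const_mul, Function.uncurry]
  exact integral_congr_ae (Eventually.of_forall fun r => by ring)

/-- Interchange of a ray integral with the integral defining a transform with bounded kernel. -/
theorem integralRay_mul_integral {ν : Measure ℝ} [SFinite ν] {θ : ℝ} {g : ℂ → ℂ} {F : ℝ → ℂ}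
    (hg : IntegrableOn (fun r : ℝ => g (r * Complex.exp (θ * Complex.I))) (Ioi 0))
    (hF : Integrable F ν) {k : ℂ → ℝ → ℂ} (hk : Continuous (Function.uncurry k))
    (hb : ∀ᵐ q : ℝ × ℝ ∂((volume.restrict (Ioi 0)).prod ν),
      ‖k (q.1 * Complex.exp (θ * Complex.I)) q.2‖ ≤ 1) :
    Integrable (fun y => F y * integralRay θ (fun lam => g lam * k lam y)) ν ∧
    integralRay θ (fun lam => g lam * ∫ y, F y * k lam y ∂ν) =
      ∫ y, F y * integralRay θ (fun lam => g lam * k lam y) ∂ν := by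
  have hg' := hg.mul_const (Complex.exp (θ * Complex.I))
  have hk' : Continuous (Function.uncurry fun (r y : ℝ) => k (r * Complex.exp (θ * Complex.I)) y) :=
    hk.comp (f := fun q : ℝ × ℝ => ((q.1 : ℂ) * Complex.exp (θ * Complex.I), q.2)) (by fun_prop)
  have h1 := integrable_mul_integral hg' hF hk' hb
  have h2 := integral_mul_integral_swap hg' hF hk' hb
  simp only [integralRay]
  simp only [mul_right_comm _ (Complex.exp (θ * Complex.I))] at h1 h2
  exact ⟨h1, h2⟩

theorem norm_exp_I_mul_ray (r θ y : ℝ) :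
    ‖Complex.exp (Complex.I * (r * Complex.exp (θ * Complex.I)) * y)‖ =
      Real.exp (-(r * Real.sin θ * y)) := by
  rw [Complex.norm_exp, Complex.exp_mul_I]
  congr 1
  simp [Complex.sin_ofReal_re]

theorem norm_exp_sq_ray (r θ y : ℝ) :
    ‖Complex.exp ((r * Complex.exp (θ * Complex.I)) ^ 2 * y)‖ =
      Real.exp (r ^ 2 * Real.cos (2 * θ) * y) := by
  rw [Complex.norm_exp, Complex.exp_mul_I, Real.cos_two_mul']
  congr 1
  simp [pow_two, Complex.sin_ofReal_re, Complex.cos_ofReal_re]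
  exact Or.inl (by ring)

theorem sin_pi_div_four_nonneg : 0 ≤ Real.sin (Real.pi / 4) :=
  Real.sin_nonneg_of_nonneg_of_le_pi (by linarith [Real.pi_pos]) (by linarith [Real.pi_pos])

theorem sin_three_pi_div_four_nonneg : 0 ≤ Real.sin (3 * Real.pi / 4) :=
  Real.sin_nonneg_of_nonneg_of_le_pi (by linarith [Real.pi_pos]) (by linarith [Real.pi_pos])

theorem cos_two_mul_pi_div_four : Real.cos (2 * (Real.pi / 4)) = 0 := by
  rw [show 2 * (Real.pi / 4) = Real.pi / 2 by ring, Real.cos_pi_div_two]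

theorem cos_two_mul_three_pi_div_four : Real.cos (2 * (3 * Real.pi / 4)) = 0 := by
  rw [show 2 * (3 * Real.pi / 4) = Real.pi / 2 + Real.pi by ring, Real.cos_add_pi,
    Real.cos_pi_div_two, neg_zero]

theorem heatPow_neg (a x t : ℝ) : heatPow a (-x, t) = heatPow a (x, t) := by
  simp [heatPow]

theorem halfLineFourier_ofReal (u : ℝ → ℂ) (w : ℝ) :
    halfLineFourier u w = lineFourier ((Ioi 0).indicator u) w := by
  rw [halfLineFourier, lineFourier, ← integral_indicator measurableSet_Ioi]
  refine integral_congr_ae (Eventually.of_forall fun y => ?_)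
  by_cases hy : y ∈ Ioi (0 : ℝ) <;> simp [hy]

/-- The contour integral involving the initial datum is the heat flow of the datum reflected in the
boundary. -/
theorem integralGamma_halfLineFourier {u : ℝ → ℂ} (hu : Integrable ((Ioi 0).indicator u)) {x t : ℝ}
    (hx : 0 < x) (ht : 0 < t) :
    1 / (2 * Real.pi) * integralGamma (fun lam => heatWave x t lam * halfLineFourier u (-lam)) =
      lineHeat ((Ioi 0).indicator u) (-x, t) := by
  have hu' : IntegrableOn u (Ioi 0) := (integrable_indicator_iff measurableSet_Ioi).1 hu
  have key : ∀ θ : ℝ, 0 ≤ Real.sin θ → Real.cos (2 * θ) = 0 →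
      Integrable (fun y : ℝ => u y * integralRay θ (heatWave (x + y) t))
        (volume.restrict (Ioi 0)) ∧
      integralRay θ (fun lam => heatWave x t lam * halfLineFourier u (-lam)) =
        ∫ y in Ioi (0 : ℝ), u y * integralRay θ (heatWave (x + y) t) := fun θ h1 h2 => by
    have hg := integrableOn_ray_heatWave 0 hx ht.ne' h1 (by rw [h2, mul_zero])
    simp only [pow_zero, one_mul] at hg
    have h := integralRay_mul_integral hg hu'
      (k := fun lam y => Complex.exp (Complex.I * lam * y)) (by unfold Function.uncurry; fun_prop)
      (by
        rw [Measure.prod_restrict]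
        refine ae_restrict_of_forall_mem (measurableSet_Ioi.prod measurableSet_Ioi) ?_
        rintro ⟨r, y⟩ ⟨hr, hy⟩
        have hr : 0 < r := hr
        have hy : 0 < y := hy
        rw [norm_exp_I_mul_ray, Real.exp_le_one_iff]
        have : 0 ≤ r * Real.sin θ * y := by positivity
        linarith)
    have h3 : ∀ y : ℝ, (fun lam => heatWave x t lam * Complex.exp (Complex.I * lam * y)) =
        heatWave (x + y) t := fun y => by
      funext lam
      rw [heatWave, heatWave, ← Complex.exp_add]
      congr 1
      push_cast
      ring
    simp only [h3] at h
    simpa only [halfLineFourier, neg_mul_neg] using h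
  obtain ⟨i1, e1⟩ := key _ sin_pi_div_four_nonneg cos_two_mul_pi_div_four
  obtain ⟨i2, e2⟩ := key _ sin_three_pi_div_four_nonneg cos_two_mul_three_pi_div_four
  rw [integralGamma_eq, e1, e2, ← integral_sub i1 i2, lineHeat_eq_integral_heatPow hu ht]
  have h4 : ∫ y in Ioi (0 : ℝ), (u y * integralRay (Real.pi / 4) (heatWave (x + y) t) -
      u y * integralRay (3 * Real.pi / 4) (heatWave (x + y) t)) =
      ∫ y in Ioi (0 : ℝ), (Real.sqrt Real.pi : ℂ) * (u y * (heatPow (1 / 2) (-x - y, t) : ℂ)) := by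
    refine setIntegral_congr_fun measurableSet_Ioi fun y hy => ?_
    have hy : 0 < y := hy
    have h5 := integralGamma_heatWave_of_pos 0 (show 0 < x + y by linarith) ht
    simp only [pow_zero, one_mul, integral_heatWave _ ht] at h5
    rw [integralGamma_eq] at h5
    rw [← mul_sub]
    erw [h5]
    rw [show -x - y = -(x + y) by ring, heatPow_neg]
    push_cast
    ring
  rw [h4, integral_const_mul, ← mul_assoc]
  congr 1
  · have h4 := ofReal_sqrt_pi_ne_zero
    rw [ofReal_pi_eq_sqrt_mul_sqrt]
    push_cast
    field_simp
  · rw [← integral_indicator measurableSet_Ioi]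
    refine integral_congr_ae (Eventually.of_forall fun y => ?_)
    by_cases hy : y ∈ Ioi (0 : ℝ) <;> simp [hy]

/-! ### The potential of the boundary datum -/

/-- The solution of the heat equation in `x > 0` with zero initial datum and boundary datum `f`, as
an integral against the Poisson kernel. -/
noncomputable def layerHeat (f : ℝ → ℂ) (p : ℝ × ℝ) : ℂ :=
  ((2 * Real.sqrt Real.pi : ℝ) : ℂ)⁻¹ * (p.1 * ∫ τ, f τ * (heatPow (3 / 2) (p.1, p.2 - τ) : ℂ))

theorem heatWave_mul_exp_sq (x t τ : ℝ) (lam : ℂ) :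
    heatWave x t lam * Complex.exp (lam ^ 2 * τ) = heatWave x (t - τ) lam := by
  rw [heatWave, heatWave, ← Complex.exp_add]
  congr 1
  push_cast
  ring

/-- The contour integral involving the boundary transform, taken for an arbitrary integrable datum `f`
on the line, is the potential `layerHeat f`. Values of `f` after the time `t` do not contribute, as the
kernel vanishes for negative times. -/
theorem integralGamma_eq_layerHeat {f : ℝ → ℂ} (hf : Integrable f) {x t : ℝ} (hx : 0 < x)
    (ht : 0 < t) :
    -(Complex.I / Real.pi) * integralGamma (fun lam => lam * heatWave x t lam *
      ∫ τ, f τ * Complex.exp (lam ^ 2 * τ)) = layerHeat f (x, t) := by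
  have key : ∀ θ : ℝ, 0 ≤ Real.sin θ → Real.cos (2 * θ) = 0 →
      Integrable (fun τ : ℝ => f τ * integralRay θ (fun lam => lam * heatWave x (t - τ) lam)) ∧
      integralRay θ (fun lam => lam * heatWave x t lam *
        ∫ τ, f τ * Complex.exp (lam ^ 2 * τ)) =
        ∫ τ, f τ * integralRay θ (fun lam => lam * heatWave x (t - τ) lam) := fun θ h1 h2 => by
    have hg := integrableOn_ray_heatWave 1 hx ht.ne' h1 (by rw [h2, mul_zero])
    simp only [pow_one] at hg
    have h := integralRay_mul_integral (g := fun lam => lam * heatWave x t lam) hg hf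
      (k := fun lam τ => Complex.exp (lam ^ 2 * τ)) (by unfold Function.uncurry; fun_prop)
      (Eventually.of_forall fun q => by rw [norm_exp_sq_ray, h2]; simp)
    simpa only [mul_assoc, heatWave_mul_exp_sq] using h
  obtain ⟨i1, e1⟩ := key _ sin_pi_div_four_nonneg cos_two_mul_pi_div_four
  obtain ⟨i2, e2⟩ := key _ sin_three_pi_div_four_nonneg cos_two_mul_three_pi_div_four
  rw [integralGamma_eq, e1, e2, ← integral_sub i1 i2, layerHeat]
  have h3 : ∫ τ, (f τ * integralRay (Real.pi / 4) (fun lam => lam * heatWave x (t - τ) lam) -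
      f τ * integralRay (3 * Real.pi / 4) (fun lam => lam * heatWave x (t - τ) lam)) =
      ∫ τ, Complex.I * x * Real.sqrt Real.pi / 2 * (f τ * (heatPow (3 / 2) (x, t - τ) : ℂ)) := by
    refine integral_congr_ae ?_
    filter_upwards [compl_mem_ae_iff.2 (measure_singleton t)] with τ hτ
    have hτ : τ ≠ t := hτ
    have h4 := integralGamma_mul_heatWave hx (sub_ne_zero.2 hτ.symm)
    rw [integralGamma_eq] at h4
    rw [← mul_sub, h4]
    push_cast
    ring
  rw [h3, integral_const_mul, ← mul_assoc, ← mul_assoc]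
  congr 1
  have h4 := ofReal_sqrt_pi_ne_zero
  rw [ofReal_pi_eq_sqrt_mul_sqrt]
  push_cast
  field_simp
  linear_combination (-(x : ℂ)) * Complex.I_sq

theorem integrable_mul_heatPow {f : ℝ → ℂ} (hf : Integrable f) {k : Set ℝ} (hk : IsCompact k)
    (hfk : ∀ τ ∉ k, f τ = 0) (a : ℝ) {x : ℝ} (hx : x ≠ 0) (t : ℝ) :
    Integrable fun τ => f τ * (heatPow a (x, t - τ) : ℂ) := by
  have hc : Continuous fun τ : ℝ => heatPow a (x, t - τ) :=
    continuous_iff_continuousAt.2 fun τ =>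
      ContinuousAt.comp (g := heatPow a) (f := fun τ : ℝ => (x, t - τ))
        (contDiffAt_heatPow a fun h => hx (congrArg Prod.fst h)).continuousAt (by fun_prop)
  obtain ⟨C, hC⟩ := hk.exists_bound_of_continuousOn hc.continuousOn
  refine (hf.norm.mul_const C).mono'
    (hf.aestronglyMeasurable.mul (Complex.continuous_ofReal.comp hc).aestronglyMeasurable)
    (Eventually.of_forall fun τ => ?_)
  by_cases hτ : τ ∈ k
  · rw [norm_mul, Complex.norm_real]
    gcongr
    exact hC τ hτ
  · rw [hfk τ hτ]
    simp

theorem contDiffAt_layerHeat {f : ℝ → ℂ} (hf : Integrable f) {k : Set ℝ} (hk : IsCompact k)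
    (hfk : ∀ τ ∉ k, f τ = 0) {p : ℝ × ℝ} (hp : p.1 ≠ 0 ∨ p.2 ∉ k) :
    ContDiffAt ℝ ∞ (layerHeat f) p := by
  refine contDiffAt_const.mul ((Complex.ofRealCLM.contDiff.contDiffAt.comp p contDiffAt_fst).mul
    (contDiffAt_integral_heatPow hf hk hfk (L := fun q τ => (q.1, q.2 - τ))
      (by unfold Function.uncurry; fun_prop) _ fun τ hτ h => ?_))
  rcases hp with hp | hp
  · exact hp (congrArg Prod.fst h)
  · have : p.2 - τ = 0 := congrArg Prod.snd h
    exact hp (by rwa [sub_eq_zero.1 this])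

theorem heatWave_ray_eq_cutWave {x θ r : ℝ} (hx : 0 ≤ x) (hr : 0 ≤ r) (t : ℝ)
    (h1 : 0 ≤ Real.sin θ) (h2 : Real.cos (2 * θ) = 0) :
    heatWave x t (r * Complex.exp (θ * Complex.I)) =
      cutWave (r * (Real.cos θ * x) - r ^ 2 * (Real.sin (2 * θ) * t), r * (Real.sin θ * x)) := by
  rw [cutWave, cutExp_of_nonneg (by positivity), heatWave, ← Complex.exp_add, mul_pow,
    ← Complex.exp_nat_mul]
  congr 1
  rw [show ((2 : ℕ) : ℂ) * (θ * Complex.I) = ((2 * θ : ℝ) : ℂ) * Complex.I by push_cast; ring,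
    Complex.exp_mul_I, Complex.exp_mul_I, ← Complex.ofReal_cos, ← Complex.ofReal_sin,
    ← Complex.ofReal_cos, ← Complex.ofReal_sin, h2]
  push_cast
  linear_combination (r * Complex.sin θ * x : ℂ) * Complex.I_sq

theorem integral_mul_exp_sq_ray (f : ℝ → ℂ) {θ : ℝ} (h2 : Real.cos (2 * θ) = 0) (r : ℝ) :
    ∫ τ, f τ * Complex.exp ((r * Complex.exp (θ * Complex.I)) ^ 2 * (τ : ℝ)) =
      lineFourier f (-(Real.sin (2 * θ) * r ^ 2)) := by
  rw [lineFourier]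
  refine integral_congr_ae (Eventually.of_forall fun τ => ?_)
  simp only
  rw [mul_pow, ← Complex.exp_nat_mul,
    show ((2 : ℕ) : ℂ) * (θ * Complex.I) = ((2 * θ : ℝ) : ℂ) * Complex.I by push_cast; ring,
    Complex.exp_mul_I, ← Complex.ofReal_cos, ← Complex.ofReal_sin, h2]
  congr 2
  push_cast
  ring

/-- For a Schwartz boundary datum, the ray integrals extend smoothly to all `(x, t) ∈ ℝ²`: as
`λ² = ± i r²` on the ray, the transform of the datum is its Fourier transform at `∓ r²`, which decays
rapidly in `r`. -/
theorem exists_contDiff_integralRay (φ : SchwartzMap ℝ ℂ) {θ : ℝ} (h1 : 0 ≤ Real.sin θ)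
    (h2 : Real.cos (2 * θ) = 0) :
    ∃ G : ℝ × ℝ → ℂ, ContDiff ℝ ∞ G ∧ ∀ p : ℝ × ℝ, 0 ≤ p.1 →
      G p = integralRay θ (fun lam => lam * heatWave p.1 p.2 lam *
        ∫ τ, φ τ * Complex.exp (lam ^ 2 * (τ : ℝ))) := by
  have hR := rapidlyDecaying_lineFourier φ
  have hσ : |Real.sin (2 * θ)| = 1 := by
    rw [abs_eq zero_le_one, ← sq_eq_one_iff, Real.sin_sq, h2]
    norm_num
  set ψ : ℝ → ℂ := fun r => r * (Complex.exp (θ * Complex.I)) ^ 2 *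
    lineFourier φ (-(Real.sin (2 * θ) * r ^ 2)) with hψ
  have hψR : RapidlyDecaying ψ := by
    have hc := hR.1
    refine ⟨by rw [hψ]; fun_prop, fun k => ?_⟩
    obtain ⟨A, hA⟩ := hR.2 0
    obtain ⟨B, hB⟩ := hR.2 (k + 1)
    refine ⟨A + B, fun r => ?_⟩
    have hA' := hA (-(Real.sin (2 * θ) * r ^ 2))
    have hB' := hB (-(Real.sin (2 * θ) * r ^ 2))
    simp only [hψ]
    set N := ‖lineFourier φ (-(Real.sin (2 * θ) * r ^ 2))‖ with hN
    rw [pow_zero, one_mul] at hA'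
    rw [abs_neg, abs_mul, hσ, one_mul, abs_pow] at hB'
    rw [norm_mul, norm_mul, norm_pow, Complex.norm_exp_ofReal_mul_I, one_pow, mul_one,
      Complex.norm_real, Real.norm_eq_abs, ← hN, ← mul_assoc, ← pow_succ]
    have h3 : |r| ^ (k + 1) ≤ 1 + (|r| ^ 2) ^ (k + 1) := by
      rw [← pow_mul, mul_comm, pow_mul]
      nlinarith [sq_nonneg (|r| ^ (k + 1) - 1), pow_nonneg (abs_nonneg r) (k + 1)]
    have hN0 : 0 ≤ N := norm_nonneg _
    calc |r| ^ (k + 1) * N ≤ (1 + (|r| ^ 2) ^ (k + 1)) * N := by gcongr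
      _ ≤ A + B := by linarith
  refine ⟨_, hψR.contDiff_integral (Ioi 0)
    (((Real.cos θ) • ContinuousLinearMap.fst ℝ ℝ ℝ).prod
      ((Real.sin θ) • ContinuousLinearMap.fst ℝ ℝ ℝ))
    ((-(Real.sin (2 * θ)) • ContinuousLinearMap.snd ℝ ℝ ℝ).prod 0), fun p hp => ?_⟩
  rw [integralRay]
  refine setIntegral_congr_fun measurableSet_Ioi fun r hr => ?_
  have hr : 0 < r := hr
  rw [heatWave_ray_eq_cutWave hp hr.le _ h1 h2, integral_mul_exp_sq_ray _ h2]
  have h5 : (r • (((Real.cos θ) • ContinuousLinearMap.fst ℝ ℝ ℝ).prod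
      ((Real.sin θ) • ContinuousLinearMap.fst ℝ ℝ ℝ)) +
    r ^ 2 • ((-(Real.sin (2 * θ)) • ContinuousLinearMap.snd ℝ ℝ ℝ).prod 0) :
      ℝ × ℝ →L[ℝ] ℝ × ℝ) p =
    (r * (Real.cos θ * p.1) - r ^ 2 * (Real.sin (2 * θ) * p.2), r * (Real.sin θ * p.1)) := by
    simp [sub_eq_add_neg]
  rw [h5]
  simp only [hψ]
  ring

theorem smoothlyExtendsAt_layerHeat_schwartz (φ : SchwartzMap ℝ ℂ) (p : ℝ × ℝ) :
    SmoothlyExtendsAt openQuadrant (layerHeat φ) p := by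
  obtain ⟨G, hG, hG'⟩ := exists_contDiff_integralRay φ sin_pi_div_four_nonneg
    cos_two_mul_pi_div_four
  obtain ⟨H, hH, hH'⟩ := exists_contDiff_integralRay φ sin_three_pi_div_four_nonneg
    cos_two_mul_three_pi_div_four
  refine ⟨fun q => -(Complex.I / Real.pi) * (G q - H q),
    (contDiff_const.mul (hG.sub hH)).contDiffAt, Eventually.of_forall fun q hq => ?_⟩
  simp only
  rw [hG' q hq.1.le, hH' q hq.1.le, ← integralGamma_eq]
  exact (integralGamma_eq_layerHeat φ.integrable hq.1 hq.2).symm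

/-! ### Smoothness of the boundary potential up to the boundary -/

/-- Integrability near `0` holds because `g` extends continuously to `0`; the value `g 0` itself plays
no role. -/
theorem IsSmoothHalfLine.integrable_indicator_Ioc {g : ℝ → ℂ} (hg : IsSmoothHalfLine g) (T : ℝ) :
    Integrable ((Ioc 0 T).indicator g) := by
  rw [integrable_indicator_iff measurableSet_Ioc]
  obtain ⟨L, hL⟩ := hg.2 0
  rw [iteratedDeriv_zero] at hL
  have h1 : ContinuousOn (Function.update g 0 L) (Icc 0 T) := by
    rw [continuousOn_update_iff]
    have h2 : Icc 0 T \ {0} ⊆ Ioi 0 := fun x hx => lt_of_le_of_ne hx.1.1 (Ne.symm hx.2)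
    exact ⟨hg.continuousOn.mono h2, fun _ => hL.mono_left (nhdsWithin_mono _ h2)⟩
  refine (h1.integrableOn_Icc.mono_set Ioc_subset_Icc_self).congr_fun (fun x hx => ?_)
    measurableSet_Ioc
  exact Function.update_of_ne hx.1.ne' _ _

theorem layerHeat_add {f g : ℝ → ℂ} (hf : Integrable f) (hg : Integrable g) {k : Set ℝ}
    (hk : IsCompact k) (hfk : ∀ τ ∉ k, f τ = 0) (hgk : ∀ τ ∉ k, g τ = 0) {p : ℝ × ℝ}
    (hp : p.1 ≠ 0) : layerHeat (f + g) p = layerHeat f p + layerHeat g p := by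
  rw [layerHeat, layerHeat, layerHeat, ← mul_add, ← mul_add,
    ← integral_add (integrable_mul_heatPow hf hk hfk _ hp _)
      (integrable_mul_heatPow hg hk hgk _ hp _)]
  simp only [Pi.add_apply, add_mul]

/-- By causality, the datum may be prolonged beyond the time `t`. -/
theorem layerHeat_indicator_Ioc_congr (g : ℝ → ℂ) {x t T : ℝ} (htT : t ≤ T) :
    layerHeat ((Ioc 0 t).indicator g) (x, t) = layerHeat ((Ioc 0 T).indicator g) (x, t) := by
  rw [layerHeat, layerHeat]
  congr 2
  refine integral_congr_ae (Eventually.of_forall fun τ => ?_)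
  simp only
  rcases le_or_gt τ t with h | h
  · rcases lt_or_ge 0 τ with h0 | h0
    · rw [indicator_of_mem (show τ ∈ Ioc 0 t from ⟨h0, h⟩),
        indicator_of_mem (show τ ∈ Ioc 0 T from ⟨h0, h.trans htT⟩)]
    · rw [indicator_of_notMem fun h1 : τ ∈ Ioc 0 t => h0.not_gt h1.1,
        indicator_of_notMem fun h1 : τ ∈ Ioc 0 T => h0.not_gt h1.1]
  · rw [heatPow, if_neg (by simp only [not_lt, sub_nonpos]; exact h.le)]
    simp

/-- The solution generated by a boundary datum on the half line is smooth up to the boundary, away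
from the corner. Close to a boundary point with `t > 0`, the datum is the sum of a smooth function
with compact support, whose contribution is a rapidly converging contour integral, and of a function
that vanishes near `t`, on whose support the Poisson kernel is smooth. -/
theorem smoothlyExtendsAt_layerHeat {g : ℝ → ℂ} (hg : IsSmoothHalfLine g) {p : ℝ × ℝ}
    (hp : p ∈ puncturedClosedQuadrant) :
    SmoothlyExtendsAt openQuadrant (fun q => layerHeat ((Ioc 0 q.2).indicator g) q) p := by
  obtain ⟨⟨hp1, hp2⟩, hp0⟩ := hp
  set T := p.2 + 1 with hT
  set f := (Ioc 0 T).indicator g with hf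
  have hfi : Integrable f := hg.integrable_indicator_Ioc T
  have hfk : ∀ τ ∉ Icc 0 T, f τ = 0 := fun τ hτ =>
    indicator_of_notMem (fun h => hτ (Ioc_subset_Icc_self h)) _
  suffices h : SmoothlyExtendsAt openQuadrant (layerHeat f) p by
    refine h.congr ?_
    have ho : IsOpen {q : ℝ × ℝ | q.2 < T} := isOpen_lt continuous_snd continuous_const
    filter_upwards [ho.mem_nhds (show p.2 < T by linarith)] with q hq _
    exact layerHeat_indicator_Ioc_congr g (le_of_lt hq)
  by_cases hx : p.1 = 0
  swap
  · exact (contDiffAt_layerHeat hfi isCompact_Icc hfk (Or.inl hx)).smoothlyExtendsAt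
  have ht : 0 < p.2 := lt_of_le_of_ne hp2 fun h => hp0 (Prod.ext hx h.symm)
  -- `c` equals `1` near `p.2` and is supported in `(p.2 / 4, T)`
  obtain ⟨c, k, hc, hk, hkV, hc1, hc0⟩ := exists_contDiff_cutoff
    (k := Icc (p.2 / 2) (p.2 + 1 / 2)) (V := Ioo (p.2 / 4) T) isCompact_Icc isOpen_Ioo
    (fun y hy => ⟨by linarith [hy.1], by linarith [hy.2]⟩)
  have hs : ContDiff ℝ ∞ (fun y => (c y : ℂ) * g y) := by
    rw [contDiff_iff_contDiffAt]
    intro y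
    rcases lt_or_ge y (p.2 / 4) with hy | hy
    · refine (contDiffAt_const (c := (0 : ℂ))).congr_of_eventuallyEq ?_
      filter_upwards [gt_mem_nhds hy] with z hz
      rw [hc0 z fun h => (lt_asymm hz (hkV h).1), Complex.ofReal_zero, zero_mul]
    · exact (Complex.ofRealCLM.contDiff.comp hc).contDiffAt.mul (hg.contDiffAt (by linarith))
  have hs0 : ∀ y ∉ k, (c y : ℂ) * g y = 0 := fun y hy => by
    rw [hc0 y hy, Complex.ofReal_zero, zero_mul]
  set φ : SchwartzMap ℝ ℂ := (HasCompactSupport.intro hk hs0).toSchwartzMap hs with hφ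
  have hφc : ∀ y, φ y = (c y : ℂ) * g y := fun y => rfl
  set f₂ : ℝ → ℂ := f - φ with hf₂
  have hf₂i : Integrable f₂ := hfi.sub φ.integrable
  have hφk : ∀ τ ∉ Icc 0 T, φ τ = 0 := fun τ hτ => by
    rw [hφc, hs0 τ fun h => hτ ⟨by linarith [(hkV h).1], (hkV h).2.le⟩]
  have hf₂T : ∀ τ ∉ Icc 0 T, f₂ τ = 0 := fun τ hτ => by
    rw [hf₂, Pi.sub_apply, hfk τ hτ, hφk τ hτ, sub_zero]
  have hf₂k : ∀ τ ∉ Icc 0 (p.2 / 2) ∪ Icc (p.2 + 1 / 2) T, f₂ τ = 0 := fun τ hτ => by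
    by_cases h : τ ∈ Icc 0 T
    · have h1 : p.2 / 2 < τ := by
        by_contra h2
        exact hτ (Or.inl ⟨h.1, not_lt.1 h2⟩)
      have h2 : τ < p.2 + 1 / 2 := by
        by_contra h2
        exact hτ (Or.inr ⟨not_lt.1 h2, h.2⟩)
      rw [hf₂, Pi.sub_apply, hφc, hc1 τ ⟨h1.le, h2.le⟩, hf,
        indicator_of_mem (show τ ∈ Ioc 0 T from ⟨by linarith, h.2⟩)]
      simp
    · exact hf₂T τ h
  have h3 : SmoothlyExtendsAt openQuadrant (layerHeat f₂) p :=
    (contDiffAt_layerHeat hf₂i (isCompact_Icc.union isCompact_Icc) hf₂k (Or.inr (by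
      rintro (h | h)
      · linarith [h.2]
      · linarith [h.1]))).smoothlyExtendsAt
  refine ((smoothlyExtendsAt_layerHeat_schwartz φ p).add h3).congr
    (Eventually.of_forall fun q hq => ?_)
  have hsum : f = φ + f₂ := by rw [hf₂]; abel
  rw [hsum, layerHeat_add φ.integrable hf₂i isCompact_Icc hφk hf₂T hq.1.ne', Pi.add_apply]

theorem boundaryTransform_eq (g : ℝ → ℂ) (lam : ℂ) {t : ℝ} (ht : 0 ≤ t) :
    boundaryTransform g lam t =
      ∫ τ, (Ioc 0 t).indicator g τ * Complex.exp (lam ^ 2 * (τ : ℝ)) := by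
  rw [boundaryTransform, intervalIntegral.integral_of_le ht, ← integral_indicator measurableSet_Ioc]
  refine integral_congr_ae (Eventually.of_forall fun τ => ?_)
  by_cases hτ : τ ∈ Ioc 0 t
  · simp only [indicator_of_mem hτ]
    rw [mul_comm]
  · simp only [indicator_of_notMem hτ, zero_mul]

/-- In the open quadrant the Fokas solution is the heat flow of the odd extension of the initial
datum plus the potential of the boundary datum. -/
theorem fokasSolution_eq {u₀ g₀ : ℝ → ℂ} (hu₀ : IsSchwartzHalfLine u₀) (hg₀ : IsSmoothHalfLine g₀)
    {p : ℝ × ℝ} (hp : p ∈ openQuadrant) :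
    fokasSolution u₀ g₀ p.1 p.2 = lineHeat ((Ioi 0).indicator u₀) p -
      lineHeat ((Ioi 0).indicator u₀) (-p.1, p.2) +
      layerHeat ((Ioc 0 p.2).indicator g₀) p := by
  obtain ⟨hx, ht⟩ := hp
  have h1 := integralGamma_halfLineFourier hu₀.integrable_indicator hx ht
  have h2 := integralGamma_eq_layerHeat (hg₀.integrable_indicator_Ioc p.2) hx ht
  simp only [← boundaryTransform_eq g₀ _ ht.le] at h2
  simp only [mul_comm _ (heatWave _ _ _)] at h2
  rw [← h1, ← h2, lineHeat]
  simp only [← halfLineFourier_ofReal]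
  change 1 / (2 * Real.pi) * (∫ lam : ℝ, heatWave p.1 p.2 lam * halfLineFourier u₀ lam) -
    1 / (2 * Real.pi) * integralGamma (fun lam => heatWave p.1 p.2 lam * halfLineFourier u₀ (-lam)) -
    Complex.I / Real.pi * integralGamma (fun lam => heatWave p.1 p.2 lam * lam *
      boundaryTransform g₀ lam p.2) = _
  ring

theorem smoothlyExtendsAt_fokasSolution {u₀ g₀ : ℝ → ℂ} (hu₀ : IsSchwartzHalfLine u₀)
    (hg₀ : IsSmoothHalfLine g₀) {p : ℝ × ℝ} (hp : p ∈ puncturedClosedQuadrant) :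
    SmoothlyExtendsAt openQuadrant (fun q => fokasSolution u₀ g₀ q.1 q.2) p := by
  have hp0 : p ≠ 0 := hp.2
  have h1 : SmoothlyExtendsAt openQuadrant (lineHeat ((Ioi 0).indicator u₀)) p :=
    (smoothlyExtendsAt_lineHeat hu₀ hp.1.2 hp0).comp (f := id) contDiff_id fun q hq => hq.2
  have h2 : SmoothlyExtendsAt openQuadrant
      (lineHeat ((Ioi 0).indicator u₀) ∘ fun q => (-q.1, q.2)) p := by
    refine (smoothlyExtendsAt_lineHeat hu₀ (p := (-p.1, p.2)) hp.1.2 fun h => hp0 ?_).comp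
      (f := fun q => (-q.1, q.2)) (by fun_prop) fun q hq => hq.2
    have h3 := congrArg Prod.fst h
    have h4 := congrArg Prod.snd h
    exact Prod.ext (neg_eq_zero.1 h3) h4
  refine ((h1.sub h2).add (smoothlyExtendsAt_layerHeat hg₀ hp)).congr
    (Eventually.of_forall fun q hq => fokasSolution_eq hu₀ hg₀ hq)

/-! ### Extension to the punctured closed quadrant -/

theorem isOpen_openQuadrant : IsOpen openQuadrant :=
  (isOpen_lt continuous_const continuous_fst).inter (isOpen_lt continuous_const continuous_snd)

theorem openQuadrant_subset : openQuadrant ⊆ puncturedClosedQuadrant := fun _ hp =>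
  ⟨⟨hp.1.le, hp.2.le⟩, fun h => hp.1.ne' (congrArg Prod.fst h)⟩

theorem puncturedClosedQuadrant_subset_closure : puncturedClosedQuadrant ⊆ closure openQuadrant := by
  have h : openQuadrant = Ioi 0 ×ˢ Ioi 0 := rfl
  rw [h, closure_prod_eq, closure_Ioi]
  exact fun p hp => hp.1

theorem uniqueDiffOn_puncturedClosedQuadrant : UniqueDiffOn ℝ puncturedClosedQuadrant :=
  ((uniqueDiffOn_Ici 0).prod (uniqueDiffOn_Ici 0)).inter isOpen_compl_singleton

theorem SmoothlyExtendsAt.tendsto {v G : ℝ × ℝ → ℂ} {p : ℝ × ℝ} {s : Set (ℝ × ℝ)}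
    (hG : ContinuousAt G p) (h : ∀ᶠ q in 𝓝 p, q ∈ s → v q = G q) :
    Tendsto v (𝓝[s] p) (𝓝 (G p)) :=
  (hG.tendsto.mono_left nhdsWithin_le_nhds).congr'
    ((eventually_nhdsWithin_iff.2 h).mono fun _ hq => hq.symm)

/-- Local smooth extensions of `v` to the boundary fit together: by density of the open quadrant
their values at the boundary are limits of `v`. -/
theorem contDiffOn_extendFrom {v : ℝ × ℝ → ℂ}
    (h : ∀ p ∈ puncturedClosedQuadrant, SmoothlyExtendsAt openQuadrant v p) :
    ContDiffOn ℝ ∞ (extendFrom openQuadrant v) puncturedClosedQuadrant := by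
  intro p hp
  obtain ⟨G, hG, hv⟩ := h p hp
  have h1 : ∀ᶠ q in 𝓝 p, ContDiffAt ℝ 1 G q :=
    (hG.of_le (by exact_mod_cast le_top)).eventually (by simp)
  have h2 : ∀ᶠ q in 𝓝 p, q ∈ puncturedClosedQuadrant → extendFrom openQuadrant v q = G q := by
    filter_upwards [h1, hv.eventually_nhds] with q h3 h4 hq
    exact extendFrom_eq (puncturedClosedQuadrant_subset_closure hq)
      (SmoothlyExtendsAt.tendsto h3.continuousAt h4)
  exact hG.contDiffWithinAt.congr_of_eventuallyEq (eventually_nhdsWithin_iff.2 h2)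
    (h2.self_of_nhds hp)

theorem extendFrom_openQuadrant_eq {v : ℝ × ℝ → ℂ}
    (h : ∀ p ∈ puncturedClosedQuadrant, SmoothlyExtendsAt openQuadrant v p) {p : ℝ × ℝ}
    (hp : p ∈ openQuadrant) : extendFrom openQuadrant v p = v p := by
  obtain ⟨G, hG, hv⟩ := h p (openQuadrant_subset hp)
  rw [extendFrom_eq (subset_closure hp) (SmoothlyExtendsAt.tendsto hG.continuousAt hv),
    hv.self_of_nhds hp]

/-- A directional derivative, taken within the punctured closed quadrant, of a function smooth there
is again smooth there; in the open quadrant it is the derivative along any curve with the given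
velocity. -/
theorem exists_contDiffOn_directionalDeriv {W : ℝ × ℝ → ℂ}
    (hW : ContDiffOn ℝ ∞ W puncturedClosedQuadrant) (e : ℝ × ℝ) :
    ∃ V : ℝ × ℝ → ℂ, ContDiffOn ℝ ∞ V puncturedClosedQuadrant ∧
      ∀ (c : ℝ → ℝ × ℝ) (r : ℝ), HasDerivAt c e r → c r ∈ openQuadrant →
        HasDerivAt (fun r => W (c r)) (V (c r)) r := by
  refine ⟨fun p => fderivWithin ℝ W puncturedClosedQuadrant p e,
    (hW.fderivWithin uniqueDiffOn_puncturedClosedQuadrant (by simp)).clm_apply contDiffOn_const,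
    fun c r hc hr => ?_⟩
  have hn : puncturedClosedQuadrant ∈ 𝓝 (c r) :=
    mem_of_superset (isOpen_openQuadrant.mem_nhds hr) openQuadrant_subset
  have h1 := (hW.contDiffAt hn).differentiableAt (by simp)
  simp only
  rw [fderivWithin_of_mem_nhds hn]
  exact h1.hasFDerivAt.comp_hasDerivAt r hc

theorem exists_contDiffOn_mixedPartial {u : ℝ → ℝ → ℂ} {U : ℝ × ℝ → ℂ}
    (hU : ContDiffOn ℝ ∞ U puncturedClosedQuadrant) (h : ∀ p ∈ openQuadrant, U p = u p.1 p.2)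
    (k l : ℕ) :
    ∃ F : ℝ × ℝ → ℂ, ContDiffOn ℝ ∞ F puncturedClosedQuadrant ∧
      ∀ p ∈ openQuadrant, F p = mixedPartial k l u p.1 p.2 := by
  induction k with
  | zero =>
    simp only [mixedPartial, iteratedDeriv_zero]
    induction l with
    | zero => exact ⟨U, hU, fun p hp => by rw [h p hp, iteratedDeriv_zero]⟩
    | succ l ih =>
      obtain ⟨W, hW, hWe⟩ := ih
      obtain ⟨V, hV, hVe⟩ := exists_contDiffOn_directionalDeriv hW (0, 1)
      refine ⟨V, hV, fun p hp => ?_⟩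
      rw [iteratedDeriv_succ, ← (hVe (fun s => (p.1, s)) p.2
        ((hasDerivAt_const _ _).prodMk (hasDerivAt_id _)) hp).deriv]
      refine Filter.EventuallyEq.deriv_eq ?_
      filter_upwards [lt_mem_nhds hp.2] with s hs
      exact hWe (p.1, s) ⟨hp.1, hs⟩
  | succ k ih =>
    obtain ⟨W, hW, hWe⟩ := ih
    obtain ⟨V, hV, hVe⟩ := exists_contDiffOn_directionalDeriv hW (1, 0)
    refine ⟨V, hV, fun p hp => ?_⟩
    rw [mixedPartial, iteratedDeriv_succ, ← (hVe (fun y => (y, p.2)) p.1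
      ((hasDerivAt_id _).prodMk (hasDerivAt_const _ _)) hp).deriv]
    refine Filter.EventuallyEq.deriv_eq ?_
    filter_upwards [lt_mem_nhds hp.1] with y hy
    exact hWe (y, p.2) ⟨hy, hp.2⟩

/-- The Fokas solution extends to a `C^∞` function on the closed quadrant without its corner, and
each of its mixed partial derivatives extends continuously to that set. -/
theorem theorem1p2 (u₀ g₀ : ℝ → ℂ) (hu₀ : IsSchwartzHalfLine u₀) (hg₀ : IsSmoothHalfLine g₀) :
    (∃ U : ℝ × ℝ → ℂ, ContDiffOn ℝ ∞ U puncturedClosedQuadrant ∧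
      ∀ p ∈ openQuadrant, U p = fokasSolution u₀ g₀ p.1 p.2) ∧
    ∀ k l : ℕ, ∃ F : ℝ × ℝ → ℂ, ContinuousOn F puncturedClosedQuadrant ∧
      ∀ p ∈ openQuadrant, F p = mixedPartial k l (fokasSolution u₀ g₀) p.1 p.2 := by
  have h := fun p hp => smoothlyExtendsAt_fokasSolution hu₀ hg₀ (p := p) hp
  have h1 := contDiffOn_extendFrom h
  have h2 : ∀ p ∈ openQuadrant, _ = fokasSolution u₀ g₀ p.1 p.2 := fun p hp =>
    extendFrom_openQuadrant_eq h hp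
  refine ⟨⟨_, h1, h2⟩, fun k l => ?_⟩
  obtain ⟨F, hF, hFe⟩ := exists_contDiffOn_mixedPartial h1 h2 k l
  exact ⟨F, hF.continuousOn, hFe⟩
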